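/- Let $M$ be a double manifold, i.e. a $2m$-dimensional manifold with an atlas of distinguished local coordinates $(x^i,\tilde x_i)_{1\le i\le m}$ whose coordinate transformations are locally of the form $x^i=\alpha^i_jx'^j+\alpha^i_0$, $\tilde x_i=\beta_i^k\tilde x'_k+\beta_i^0$, with constants satisfying $\alpha^i_j\beta_i^k=\delta_j^k$. Let $L,\tilde L\subset TM$ be the tangent bundles of the foliations $\tilde x_i=\mathrm{const.}$ and $x^i=\mathrm{const.}$, so that $TM=L\oplus\tilde L$; let $pr_L:TM\to L\cong TM/\tilde L$ be the projection; let $\gamma$ be the metric with $\gamma(\partial/\partial x^i,\partial/\partial\tilde x_j)=\delta_i^j$ for which $L,\tilde L$ are isotropic; and let $\nabla^0$ be the flat connection with $\nabla^0(\partial/\partial x^i)=\nabla^0(\partial/\partial\tilde x_i)=0$. The $\nabla^0$-bracket of vector fields is $$[X,Y]_{\nabla^0}=\nabla^0_XY-\nabla^0_YX-X\wedge_{\nabla^0}Y,\qquad \gamma(Z,X\wedge_{\nabla^0}Y)=\tfrac12\big[\gamma(X,\nabla^0_ZY)-\gamma(Y,\nabla^0_ZX)\big].$$ A function is foliated if it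 is smooth and its differential vanishes on $\tilde L$. The distinguished frames $(\partial/\partial x^i,\partial/\partial\tilde x_i)$ make $TM$ an $\tilde L$-foliated vector bundle; its foliated cross sections over an open set (strongly foliated vector fields) are those whose components in these frames are foliated functions. A vector field is foliated if it is smooth and its Lie bracket with any field tangent to $\tilde L$ is tangent to $\tilde L$; foliated cross sections of $TM/\tilde L$ are those locally represented by foliated vector fields, with the bracket induced by the Lie bracket. For a foliated function $f$, let $\partial f$ be the vector field defined by $\gamma(\partial f,e)=\frac12(pr_L\,e)f$. Then $(TM,\gamma,pr_L)$ with the $\nabla^0$-bracket is an $\tilde L$-transversal Courant algebroid on $M$. That is: $\tilde L$ is a foliation and the distinguished frames define an $\tilde L$-foliated structure on $TM$; $\gamma$ is symmetric, non degenerate and foliated (it takes foliated values on strongly foliated fields); $pr_L$ sends strongly foliated fields to foliated cross sections of $TM/\tilde L$; $\partial$ sends foliated functions to strongly foliated fields; the $\nabla^0$-bracket is a local operation, and on the strongly foliated vector fields over any open subset of $M$ it is closed, $\mathbb R$-bilinear and skew symmetric; and for all strongly foliated $e,e_1,e_2,e_3$ and all foliated functions $f$ on an open subset of $M$ one has, with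 $[\,,]=[\,,]_{\nabla^0}$ except on the right hand side of (2), where it is the bracket of $TM/\tilde L$: 1. $\sum_{Cycl}[[e_1,e_2],e_3]=\frac13\,\partial\Big(\sum_{Cycl}\gamma([e_1,e_2],e_3)\Big)$; 2. $pr_L[e_1,e_2]=[pr_Le_1,pr_Le_2]$; 3. $[e_1,fe_2]=f[e_1,e_2]+((pr_Le_1)f)\,e_2-\gamma(e_1,e_2)\,\partial f$; 4. $pr_L(\partial f)=0$; 5. $(pr_Le)(\gamma(e_1,e_2))=\gamma([e,e_1]+\partial(\gamma(e,e_1)),e_2)+\gamma(e_1,[e,e_2]+\partial(\gamma(e,e_2)))$. -/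

import Mathlib

open scoped Manifold ContDiff Topology
open Bundle

noncomputable section

namespace DoubleField

/-! ### Foliations, foliated objects and transversal Courant algebroids -/

section Foliated

variable {B : Type*} [NormedAddCommGroup B] [NormedSpace ℝ B]
  {M : Type*} [TopologicalSpace M] [ChartedSpace B M]

/-- `F` is the tangent bundle of a foliation: around every point there is a smooth chart of `M` in
which `F` is the constant distribution `W`, i.e. in which the leaves are the slices parallel
to `W`. -/
def IsFoliation (F : ∀ x : M, Submodule ℝ (TangentSpace 𝓘(ℝ, B) x)) : Prop :=
  ∃ W : Submodule ℝ B, ∀ x : M, ∃ φ ∈ IsManifold.maximalAtlas 𝓘(ℝ, B) ∞ M, x ∈ φ.source ∧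
    ∀ y ∈ φ.source, ∀ v : TangentSpace 𝓘(ℝ, B) y,
      v ∈ F y ↔ (mfderiv 𝓘(ℝ, B) 𝓘(ℝ, B) φ y v : B) ∈ W

/-- `f` is a foliated function on the open set `U`: it is smooth and its differential vanishes on
the leaves (so that, locally, it is the lift of a smooth function on the space of leaves). -/
def IsFoliatedFun (F : ∀ x : M, Submodule ℝ (TangentSpace 𝓘(ℝ, B) x)) (U : Set M)
    (f : M → ℝ) : Prop :=
  ContMDiffOn 𝓘(ℝ, B) 𝓘(ℝ, ℝ) ∞ f U ∧
    ∀ x ∈ U, ∀ v ∈ F x, (mfderiv 𝓘(ℝ, B) 𝓘(ℝ, ℝ) f x v : ℝ) = 0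

/-- The differential of a foliated function, as a linear form on the transversal (normal) space
`T_x M / F_x` of the foliation. -/
def transDiff (F : ∀ x : M, Submodule ℝ (TangentSpace 𝓘(ℝ, B) x)) (f : M → ℝ) (x : M) :
    (TangentSpace 𝓘(ℝ, B) x ⧸ F x) →ₗ[ℝ] ℝ :=
  letI d : TangentSpace 𝓘(ℝ, B) x →ₗ[ℝ] ℝ :=
    (show TangentSpace 𝓘(ℝ, B) x →L[ℝ] ℝ from mfderiv 𝓘(ℝ, B) 𝓘(ℝ, ℝ) f x).toLinearMap
  open scoped Classical in
  if h : F x ≤ LinearMap.ker d then (F x).liftQ d h else 0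

variable [IsManifold 𝓘(ℝ, B) ∞ M]

/-- `X` is a smooth vector field on the open set `U`. -/
def IsSmoothVF (U : Set M) (X : ∀ x : M, TangentSpace 𝓘(ℝ, B) x) : Prop :=
  haveI : IsManifold 𝓘(ℝ, B) 1 M := IsManifold.of_le (n := ∞) (by simp)
  ContMDiffOn 𝓘(ℝ, B) (𝓘(ℝ, B).prod 𝓘(ℝ, B)) ∞
    (fun x => (⟨x, X x⟩ : TotalSpace B (TangentSpace 𝓘(ℝ, B) : M → Type _))) U

/-- `X` is a foliated (projectable) vector field on the open set `U`: it is smooth and its flow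
preserves the foliation, i.e. its Lie bracket with every field tangent to the leaves is tangent to
the leaves. -/
def IsFoliatedVF (F : ∀ x : M, Submodule ℝ (TangentSpace 𝓘(ℝ, B) x)) (U : Set M)
    (X : ∀ x : M, TangentSpace 𝓘(ℝ, B) x) : Prop :=
  IsSmoothVF U X ∧ ∀ V ⊆ U, IsOpen V → ∀ Z : ∀ x : M, TangentSpace 𝓘(ℝ, B) x,
    IsSmoothVF V Z → (∀ x ∈ V, Z x ∈ F x) →
      ∀ x ∈ V, VectorField.mlieBracket 𝓘(ℝ, B) X Z x ∈ F x

variable {V : Type*} [NormedAddCommGroup V] [NormedSpace ℝ V]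
  {E : M → Type*} [∀ x, AddCommGroup (E x)] [∀ x, Module ℝ (E x)]

/-- `s` is a foliated cross section over the open set `U` of the vector bundle `E`, whose foliated
structure is given by the local frames `p.2` on the open sets `p.1`, `p ∈ A`: the components of `s`
with respect to each of these frames are foliated functions. -/
def IsFoliatedSec {ι : Type*} [Fintype ι] (F : ∀ x : M, Submodule ℝ (TangentSpace 𝓘(ℝ, B) x))
    (A : Set (Set M × (ι → ∀ x, E x))) (U : Set M) (s : ∀ x, E x) : Prop :=
  ∀ p ∈ A, ∃ ξ : ι → M → ℝ, (∀ i, IsFoliatedFun F (U ∩ p.1) (ξ i)) ∧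
    ∀ x ∈ U ∩ p.1, s x = ∑ i, ξ i x • p.2 i x

/-- The operator `∂ = (1/2) ♯_g ᵗρ d`, applied to a foliated function. Here `♭_g` is `g x`, and
`♯_g` is its inverse. -/
def transPartial (F : ∀ x : M, Submodule ℝ (TangentSpace 𝓘(ℝ, B) x))
    (g : ∀ x, E x →ₗ[ℝ] E x →ₗ[ℝ] ℝ)
    (ρ : ∀ x, E x →ₗ[ℝ] (TangentSpace 𝓘(ℝ, B) x ⧸ F x)) (f : M → ℝ) : ∀ x, E x :=
  fun x => (1 / 2 : ℝ) • Function.invFun (g x) ((transDiff F f x).comp (ρ x))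

/-- A family of local frames `p.2` on open sets `p.1`, `p ∈ A`, that makes the smooth vector bundle
`E` into a foliated vector bundle over `(M, F)`: the frames are smooth, their domains cover `M`,
and the transition functions between any two of them are foliated. -/
structure IsFoliatedBundle {ι : Type*} [Fintype ι] [TopologicalSpace (TotalSpace V E)]
    [∀ x, TopologicalSpace (E x)] [FiberBundle V E]
    (F : ∀ x : M, Submodule ℝ (TangentSpace 𝓘(ℝ, B) x))
    (A : Set (Set M × (ι → ∀ x, E x))) : Prop where
  isOpen : ∀ p ∈ A, IsOpen p.1
  frame : ∀ p ∈ A, IsLocalFrameOn 𝓘(ℝ, B) V ∞ p.2 p.1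
  cover : ∀ x : M, ∃ p ∈ A, x ∈ p.1
  transition : ∀ p ∈ A, ∀ i, IsFoliatedSec F A p.1 (p.2 i)

/-- `(E, g, ρ, br)` is an `F`-transversal Courant algebroid over the foliated manifold `(M, F)`.
Here `E` is a vector bundle with the foliated structure defined by the local frames `A`, `g` is a
foliated metric on `E`, the anchor `ρ` is a foliated morphism from `E` to the transversal bundle
`TM / F`, and `br` is a skew symmetric, real bilinear bracket of foliated local cross
sections (a morphism of sheaves, which is the content of `bracket_local`: the values of `br s t`
near a point depend only on `s` and `t` near that point); these data satisfy the axioms of a Courant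
algebroid on foliated functions and foliated cross sections over every open set (in particular,
over `M`). -/
structure IsTransversalCourantAlgebroid {ι : Type*} [Fintype ι]
    [TopologicalSpace (TotalSpace V E)] [∀ x, TopologicalSpace (E x)] [FiberBundle V E]
    [VectorBundle ℝ V E] [ContMDiffVectorBundle ∞ V E 𝓘(ℝ, B)]
    (F : ∀ x : M, Submodule ℝ (TangentSpace 𝓘(ℝ, B) x))
    (A : Set (Set M × (ι → ∀ x, E x)))
    (g : ∀ x, E x →ₗ[ℝ] E x →ₗ[ℝ] ℝ)
    (ρ : ∀ x, E x →ₗ[ℝ] (TangentSpace 𝓘(ℝ, B) x ⧸ F x))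
    (br : (∀ x, E x) → (∀ x, E x) → (∀ x, E x)) : Prop where
  foliation : IsFoliation F
  bundle : IsFoliatedBundle (V := V) F A
  metric_symm : ∀ x v w, g x v w = g x w v
  metric_nondegenerate : ∀ x v, (∀ w, g x v w = 0) → v = 0
  metric_foliated : ∀ U : Set M, IsOpen U → ∀ s t, IsFoliatedSec F A U s →
    IsFoliatedSec F A U t → IsFoliatedFun F U (fun x => g x (s x) (t x))
  /-- the anchor sends foliated cross sections of `E` to foliated cross sections of `TM / F`, i.e.
  to those that are, locally, the classes of foliated vector fields -/
  anchor_foliated : ∀ U : Set M, IsOpen U → ∀ s, IsFoliatedSec F A U s → ∀ x ∈ U,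
    ∃ U' ⊆ U, IsOpen U' ∧ x ∈ U' ∧ ∃ X, IsFoliatedVF F U' X ∧
      ∀ y ∈ U', ρ y (s y) = (F y).mkQ (X y)
  partial_foliated : ∀ U : Set M, IsOpen U → ∀ f, IsFoliatedFun F U f →
    IsFoliatedSec F A U (transPartial F g ρ f)
  bracket_local : ∀ s s' t t' : ∀ x, E x, ∀ x, (∀ᶠ y in 𝓝 x, s y = s' y) →
    (∀ᶠ y in 𝓝 x, t y = t' y) → br s t x = br s' t' x
  bracket_foliated : ∀ U : Set M, IsOpen U → ∀ s t, IsFoliatedSec F A U s →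
    IsFoliatedSec F A U t → IsFoliatedSec F A U (br s t)
  bracket_add : ∀ U : Set M, IsOpen U → ∀ s s' t, IsFoliatedSec F A U s →
    IsFoliatedSec F A U s' → IsFoliatedSec F A U t →
      ∀ x ∈ U, br (s + s') t x = br s t x + br s' t x
  bracket_smul : ∀ U : Set M, IsOpen U → ∀ (c : ℝ) s t, IsFoliatedSec F A U s →
    IsFoliatedSec F A U t → ∀ x ∈ U, br (c • s) t x = c • br s t x
  bracket_skew : ∀ U : Set M, IsOpen U → ∀ s t, IsFoliatedSec F A U s →
    IsFoliatedSec F A U t → ∀ x ∈ U, br s t x = - br t s x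
  /-- the Jacobiator is `∂` of one third of the cyclic sum of `g([e₁, e₂], e₃)` -/
  jacobi : ∀ U : Set M, IsOpen U → ∀ e₁ e₂ e₃, IsFoliatedSec F A U e₁ →
    IsFoliatedSec F A U e₂ → IsFoliatedSec F A U e₃ → ∀ x ∈ U,
      br (br e₁ e₂) e₃ x + br (br e₂ e₃) e₁ x + br (br e₃ e₁) e₂ x =
        (1 / 3 : ℝ) • transPartial F g ρ (fun y => g y (br e₁ e₂ y) (e₃ y) +
          g y (br e₂ e₃ y) (e₁ y) + g y (br e₃ e₁ y) (e₂ y)) x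
  /-- `ρ [e₁, e₂] = [ρ e₁, ρ e₂]`, where the bracket of the foliated cross sections of `TM / F`
  represented by the foliated vector fields `X₁`, `X₂` is represented by `[X₁, X₂]` -/
  anchor_bracket : ∀ U : Set M, IsOpen U → ∀ e₁ e₂, IsFoliatedSec F A U e₁ →
    IsFoliatedSec F A U e₂ → ∀ X₁ X₂, IsFoliatedVF F U X₁ → IsFoliatedVF F U X₂ →
      (∀ x ∈ U, ρ x (e₁ x) = (F x).mkQ (X₁ x)) → (∀ x ∈ U, ρ x (e₂ x) = (F x).mkQ (X₂ x)) →
        ∀ x ∈ U, ρ x (br e₁ e₂ x) = (F x).mkQ (VectorField.mlieBracket 𝓘(ℝ, B) X₁ X₂ x)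
  /-- `[e₁, f e₂] = f [e₁, e₂] + ((ρ e₁) f) e₂ - g(e₁, e₂) ∂f` -/
  leibniz : ∀ U : Set M, IsOpen U → ∀ e₁ e₂ f, IsFoliatedSec F A U e₁ →
    IsFoliatedSec F A U e₂ → IsFoliatedFun F U f → ∀ x ∈ U,
      br e₁ (fun y => f y • e₂ y) x = f x • br e₁ e₂ x + transDiff F f x (ρ x (e₁ x)) • e₂ x -
        g x (e₁ x) (e₂ x) • transPartial F g ρ f x
  /-- `ρ ∘ ∂ = 0` -/
  anchor_partial : ∀ U : Set M, IsOpen U → ∀ f, IsFoliatedFun F U f → ∀ x ∈ U,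
    ρ x (transPartial F g ρ f x) = 0
  /-- `(ρ e) g(e₁, e₂) = g([e, e₁] + ∂ g(e, e₁), e₂) + g(e₁, [e, e₂] + ∂ g(e, e₂))` -/
  compatible : ∀ U : Set M, IsOpen U → ∀ e e₁ e₂, IsFoliatedSec F A U e →
    IsFoliatedSec F A U e₁ → IsFoliatedSec F A U e₂ → ∀ x ∈ U,
      transDiff F (fun y => g y (e₁ y) (e₂ y)) x (ρ x (e x)) =
        g x (br e e₁ x + transPartial F g ρ (fun y => g y (e y) (e₁ y)) x) (e₂ x) +
        g x (e₁ x) (br e e₂ x + transPartial F g ρ (fun y => g y (e y) (e₂ y)) x)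

end Foliated

/-! ### Double manifolds -/

/-- The model space of the double of an `m`-dimensional manifold, with coordinates
`(x¹, …, xᵐ)` (first factor) and `(x̃₁, …, x̃ₘ)` (second factor). -/
abbrev DModel (m : ℕ) : Type := (Fin m → ℝ) × (Fin m → ℝ)

/-- The property of being, locally, of the form `(x, x̃) ↦ (α x + α₀, β x̃ + β₀)` with constant
matrices `α`, `β` such that `ᵗα β = 1`. -/
def doublePregroupoid (m : ℕ) : Pregroupoid (DModel m) where
  property f s := ∀ z ∈ s, ∃ (α β : Matrix (Fin m) (Fin m) ℝ) (a b : Fin m → ℝ),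
    α.transpose * β = 1 ∧
      ∀ᶠ y in 𝓝 z, f y = (α.mulVec y.1 + a, β.mulVec y.2 + b)
  comp := by
    intro f g u v hf hg _ _ _ z hz
    obtain ⟨α, β, a, b, h, hfz⟩ := hf z hz.1
    obtain ⟨α', β', a', b', h', hgz⟩ := hg (f z) hz.2
    refine ⟨α' * α, β' * β, α'.mulVec a + a', β'.mulVec b + b', ?_, ?_⟩
    · rw [Matrix.transpose_mul, Matrix.mul_assoc, ← Matrix.mul_assoc α'.transpose, h',
        Matrix.one_mul, h]
    · have hc : ContinuousAt f z := by
        have : Continuous fun y : DModel m => (α.mulVec y.1 + a, β.mulVec y.2 + b) := by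
          fun_prop
        exact this.continuousAt.congr (hfz.mono fun y hy => hy.symm)
      filter_upwards [hfz, hc.eventually hgz] with y hy hy'
      rw [Function.comp_apply, hy', hy]
      simp only [Matrix.mulVec_add, Matrix.mulVec_mulVec, add_assoc]
  id_mem := fun z _ => ⟨1, 1, 0, 0, by simp, by simp⟩
  locality := by
    intro f u _ h z hz
    obtain ⟨v, _, hzv, hv⟩ := h z hz
    exact hv z ⟨hz, hzv⟩
  congr := by
    intro f g u hu hfg hf z hz
    obtain ⟨α, β, a, b, h, hfz⟩ := hf z hz
    refine ⟨α, β, a, b, h, ?_⟩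
    filter_upwards [hfz, hu.mem_nhds hz] with y hy hyu
    rw [hfg y hyu, hy]

/-- The groupoid of the distinguished coordinate transformations. -/
def doubleGroupoid (m : ℕ) : StructureGroupoid (DModel m) :=
  (doublePregroupoid m).groupoid

theorem doubleGroupoid_le (m : ℕ) (n : ℕ∞ω) :
    doubleGroupoid m ≤ contDiffGroupoid n 𝓘(ℝ, DModel m) := by
  have key : ∀ (f : DModel m → DModel m) (s : Set (DModel m)), (doublePregroupoid m).property f s →
      ContDiffOn ℝ n f s := by
    intro f s h z hz
    obtain ⟨α, β, a, b, -, hz'⟩ := h z hz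
    have h1 : ContDiff ℝ n fun y : DModel m => (α.mulVec y.1 + a, β.mulVec y.2 + b) := by
      have e1 : ContDiff ℝ n fun y : DModel m => α.mulVec y.1 :=
        (((Matrix.mulVecLin α).toContinuousLinearMap).contDiff).comp contDiff_fst
      have e2 : ContDiff ℝ n fun y : DModel m => β.mulVec y.2 :=
        (((Matrix.mulVecLin β).toContinuousLinearMap).contDiff).comp contDiff_snd
      exact (e1.add contDiff_const).prodMk (e2.add contDiff_const)
    exact (h1.contDiffAt.congr_of_eventuallyEq hz').contDiffWithinAt
  intro e he
  refine mem_groupoid_of_pregroupoid.2 ⟨?_, ?_⟩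
  · simpa [contDiffPregroupoid] using key e e.source he.1
  · simpa [contDiffPregroupoid] using key e.symm e.target he.2

section Double

variable {m : ℕ} {M : Type*} [TopologicalSpace M] [ChartedSpace (DModel m) M]

/-- A double manifold, i.e. a manifold with an atlas whose coordinate transformations are
distinguished, is a smooth manifold. -/
instance instIsManifoldOfDouble [HasGroupoid M (doubleGroupoid m)] (n : ℕ∞ω) :
    IsManifold 𝓘(ℝ, DModel m) n M :=
  haveI : HasGroupoid M (contDiffGroupoid n 𝓘(ℝ, DModel m)) :=
    hasGroupoid_of_le ‹_› (doubleGroupoid_le m n)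
  IsManifold.mk' 𝓘(ℝ, DModel m) n M

/-- The coordinate functions of a chart: `x^i` for the index `Sum.inl i` and `x̃_i` for the index
`Sum.inr i`. -/
def coord (φ : OpenPartialHomeomorph M (DModel m)) (k : Fin m ⊕ Fin m) (y : M) : ℝ :=
  Sum.elim (φ y).1 (φ y).2 k

/-- The coordinate differentials `dx^i`, `dx̃_i` of a chart. -/
def dcoord (φ : OpenPartialHomeomorph M (DModel m)) (k : Fin m ⊕ Fin m) (y : M) :
    TangentSpace 𝓘(ℝ, DModel m) y →L[ℝ] ℝ :=
  mfderiv 𝓘(ℝ, DModel m) 𝓘(ℝ, ℝ) (coord φ k) y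

/-- The standard basis of the model space. -/
def modelBasis (m : ℕ) : Fin m ⊕ Fin m → DModel m :=
  Sum.elim (fun i => (Pi.single i 1, 0)) (fun i => (0, Pi.single i 1))

/-- The coordinate vector fields `∂/∂x^i`, `∂/∂x̃_i` of a chart. -/
def coordVF (φ : OpenPartialHomeomorph M (DModel m)) (k : Fin m ⊕ Fin m) (y : M) :
    TangentSpace 𝓘(ℝ, DModel m) y :=
  (mfderiv 𝓘(ℝ, DModel m) 𝓘(ℝ, DModel m) φ y).inverse (modelBasis m k)

/-! The objects below are expressed by distinguished coordinates around the point `x`, those of the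
preferred chart at `x`. By the form of the distinguished coordinate transformations, any other
distinguished coordinates yield the same object. -/

variable (m M) in
/-- The tangent bundle of the foliation `L̃` with the leaves `x^i = const.` -/
def foliationLt (x : M) : Submodule ℝ (TangentSpace 𝓘(ℝ, DModel m) x) :=
  ⨅ i : Fin m, LinearMap.ker (dcoord (chartAt (DModel m) x) (Sum.inl i) x).toLinearMap

variable (m M) in
/-- The metric `γ`, i.e. the symmetric tensor field with `γ(∂/∂x^i, ∂/∂x̃_j) = δ_i^j` for which the
foliations `x̃_i = const.` and `x^i = const.` are isotropic. -/
def gammaMetric (x : M) :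
    TangentSpace 𝓘(ℝ, DModel m) x →ₗ[ℝ] TangentSpace 𝓘(ℝ, DModel m) x →ₗ[ℝ] ℝ :=
  letI d (k : Fin m ⊕ Fin m) : TangentSpace 𝓘(ℝ, DModel m) x →ₗ[ℝ] ℝ :=
    (dcoord (chartAt (DModel m) x) k x).toLinearMap
  ∑ i : Fin m, ((d (Sum.inl i)).smulRight (d (Sum.inr i)) +
    (d (Sum.inr i)).smulRight (d (Sum.inl i)))

variable (m M) in
/-- The projection `pr_L` of `TM = L ⊕ L̃` onto `L`, where `L` is spanned by the `∂/∂x^i`. -/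
def prL (x : M) : TangentSpace 𝓘(ℝ, DModel m) x →ₗ[ℝ] TangentSpace 𝓘(ℝ, DModel m) x :=
  ∑ i : Fin m, (dcoord (chartAt (DModel m) x) (Sum.inl i) x).toLinearMap.smulRight
    (coordVF (chartAt (DModel m) x) (Sum.inl i) x)

variable (m M) in
/-- `pr_L` as an anchor, with values in the transversal bundle `TM / L̃ ≅ L`. -/
def anchorL (x : M) : TangentSpace 𝓘(ℝ, DModel m) x →ₗ[ℝ]
    (TangentSpace 𝓘(ℝ, DModel m) x ⧸ foliationLt m M x) :=
  (foliationLt m M x).mkQ.comp (prL m M x)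

/-- The canonical flat connection, `∇⁰(∂/∂x^i) = 0`, `∇⁰(∂/∂x̃_i) = 0`; its value at `x` is the
linear map `v ↦ ∇⁰_v Y`, obtained by differentiating the components of `Y`. -/
def nabla0 (Y : ∀ x : M, TangentSpace 𝓘(ℝ, DModel m) x) (x : M) :
    TangentSpace 𝓘(ℝ, DModel m) x →L[ℝ] TangentSpace 𝓘(ℝ, DModel m) x :=
  ∑ k : Fin m ⊕ Fin m,
    (show TangentSpace 𝓘(ℝ, DModel m) x →L[ℝ] ℝ from mfderiv 𝓘(ℝ, DModel m) 𝓘(ℝ, ℝ)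
      (fun y => dcoord (chartAt (DModel m) x) k y (Y y)) x).smulRight
        (coordVF (chartAt (DModel m) x) k x)

/-- The product `X ∧_{∇⁰} Y`, defined by
`γ(Z, X ∧_{∇⁰} Y) = (1/2) [γ(X, ∇⁰_Z Y) - γ(Y, ∇⁰_Z X)]`. -/
def wedge0 (X Y : ∀ x : M, TangentSpace 𝓘(ℝ, DModel m) x) (x : M) :
    TangentSpace 𝓘(ℝ, DModel m) x :=
  Function.invFun (gammaMetric m M x)
    ((1 / 2 : ℝ) • ((gammaMetric m M x (X x)).comp (nabla0 Y x).toLinearMap -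
      (gammaMetric m M x (Y x)).comp (nabla0 X x).toLinearMap))

/-- The `∇⁰`-bracket `[X, Y]_{∇⁰} = ∇⁰_X Y - ∇⁰_Y X - X ∧_{∇⁰} Y`. -/
def bracket0 (X Y : ∀ x : M, TangentSpace 𝓘(ℝ, DModel m) x) (x : M) :
    TangentSpace 𝓘(ℝ, DModel m) x :=
  nabla0 Y x (X x) - nabla0 X x (Y x) - wedge0 X Y x

variable (m M) in
/-- The `L̃`-foliated structure of `TM`, given by the frames `(∂/∂x^i, ∂/∂x̃_i)` of all the
distinguished charts. The corresponding foliated cross sections are the strongly foliated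
vector fields. -/
def distinguishedFrames :
    Set (Set M × (Fin m ⊕ Fin m → ∀ x : M, TangentSpace 𝓘(ℝ, DModel m) x)) :=
  {p | ∃ φ ∈ (doubleGroupoid m).maximalAtlas M, p = (φ.source, coordVF φ)}

end Double

end DoubleField

end

open scoped Manifold ContDiff Topology
open Bundle
noncomputable section
set_option linter.unusedSectionVars false

namespace DoubleField

/-! ### Distinguished coordinates on the model space and on the manifold -/

section

variable {m : ℕ} {M : Type*} [TopologicalSpace M] [ChartedSpace (DModel m) M]

/-! In distinguished coordinates a strongly foliated field is a pair (a^i, b_i) of tuples of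
functions of the x^i alone: locally, a vector field and a 1-form on the space of leaves of L̃. There
γ is the pairing a·b' + b·a', the anchor remembers a only (`anchorL_apply`), and ∂f is (0, ½ df).
The ∇⁰-bracket has a-part a^j ∂_j a'^i − a'^j ∂_j a^i, which is the Lie bracket, and b-part a^j ∂_j
b'_i − a'^j ∂_j b_i − ½ (a^j ∂_i b'_j + b_j ∂_i a'^j − a'^j ∂_i b_j − b'_j ∂_i a^j), which is that
of the Courant bracket on vector fields plus 1-forms (`comp_bracket0_inl`, `comp_bracket0_inr`). The
theorem thus says locally that the standard Courant algebroid of the leaf space satisfies its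
axioms; these are verified here by computation in coordinates.

The coordinates may be chosen freely because changes of distinguished charts have locally constant
matrices α, β with ᵗα β = 1 (`dcoord_transition`). Constancy makes derivatives of components
transform like the components themselves (`dcoord_nabla0`); duality makes the coordinate formula for
γ chart independent (`gammaMetric_apply`). Since partial derivatives commute, ∂/∂x^i of a foliated
function is foliated (`IsFoliatedFun.pd`), so the bracket and ∂ stay among foliated objects.

Additivity, skew symmetry and the Leibniz rule hold summand by summand. The Jacobi and metric
compatibility axioms become polynomial identities in jets at one point (`CompJet.jacobi_a`,
`CompJet.jacobi_b`, `CompJet.compatible`): the difference of the two sides is a double sum over j, k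
of a term antisymmetric in j, k. Compatibility of the anchor with brackets follows from the
coordinate formula for the Lie bracket (`dcoord_mlieBracket`). -/

/-- The coordinates of the model space, as continuous linear forms. -/
def modelCoord (k : Fin m ⊕ Fin m) : DModel m →L[ℝ] ℝ :=
  Sum.elim (fun i => (ContinuousLinearMap.proj i).comp (ContinuousLinearMap.fst ℝ _ _))
    (fun i => (ContinuousLinearMap.proj i).comp (ContinuousLinearMap.snd ℝ _ _)) k

@[simp] theorem modelCoord_inl (i : Fin m) (z : DModel m) : modelCoord (Sum.inl i) z = z.1 i := rfl

@[simp] theorem modelCoord_inr (i : Fin m) (z : DModel m) : modelCoord (Sum.inr i) z = z.2 i := rfl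

theorem coord_eq (φ : OpenPartialHomeomorph M (DModel m)) (k : Fin m ⊕ Fin m) :
    coord φ k = modelCoord k ∘ φ := by
  funext y; cases k <;> rfl

theorem modelCoord_modelBasis (k l : Fin m ⊕ Fin m) :
    modelCoord k (modelBasis m l) = if k = l then 1 else 0 := by
  rcases k with i | i <;> rcases l with j | j <;> simp [modelBasis, Pi.single_apply]

theorem sum_modelCoord_smul_modelBasis (z : DModel m) :
    ∑ k, modelCoord k z • modelBasis m k = z := by
  have h1 (z : DModel m) : z.1 = ∑ i, modelCoord (Sum.inl i) z • (Pi.single i 1 : Fin m → ℝ) := by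
    funext j; simp [Finset.sum_apply, Pi.single_apply]
  have h2 (z : DModel m) : z.2 = ∑ i, modelCoord (Sum.inr i) z • (Pi.single i 1 : Fin m → ℝ) := by
    funext j; simp [Finset.sum_apply, Pi.single_apply]
  refine Prod.ext ?_ ?_
  · rw [Prod.fst_sum, Fintype.sum_sum_type]
    simpa [modelBasis] using (h1 z).symm
  · rw [Prod.snd_sum, Fintype.sum_sum_type]
    simpa [modelBasis] using (h2 z).symm

theorem model_ext {z w : DModel m} (h : ∀ k, modelCoord k z = modelCoord k w) : z = w := by
  rw [← sum_modelCoord_smul_modelBasis z, ← sum_modelCoord_smul_modelBasis w]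
  simp [h]

/-! ### Distinguished charts: dual frames and transition matrices -/

section Charts

variable [HasGroupoid M (doubleGroupoid m)] {φ ψ : OpenPartialHomeomorph M (DModel m)}

theorem mem_smoothAtlas (hφ : φ ∈ (doubleGroupoid m).maximalAtlas M) (n : ℕ∞ω) :
    φ ∈ IsManifold.maximalAtlas 𝓘(ℝ, DModel m) n M :=
  StructureGroupoid.maximalAtlas_mono (doubleGroupoid_le m n) hφ

theorem chart_mem_doubleAtlas (x : M) :
    chartAt (DModel m) x ∈ (doubleGroupoid m).maximalAtlas M :=
  StructureGroupoid.chart_mem_maximalAtlas _ x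

theorem mdifferentiable_chart (hφ : φ ∈ (doubleGroupoid m).maximalAtlas M) :
    φ.MDifferentiable 𝓘(ℝ, DModel m) 𝓘(ℝ, DModel m) :=
  ⟨(contMDiffOn_of_mem_maximalAtlas (mem_smoothAtlas hφ 1)).mdifferentiableOn one_ne_zero,
    (contMDiffOn_symm_of_mem_maximalAtlas (mem_smoothAtlas hφ 1)).mdifferentiableOn one_ne_zero⟩

theorem dcoord_apply (hφ : φ ∈ (doubleGroupoid m).maximalAtlas M) {y : M} (hy : y ∈ φ.source)
    (k : Fin m ⊕ Fin m) (v : TangentSpace 𝓘(ℝ, DModel m) y) :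
    dcoord φ k y v = modelCoord k (mfderiv 𝓘(ℝ, DModel m) 𝓘(ℝ, DModel m) φ y v) := by
  have h1 : MDifferentiableAt 𝓘(ℝ, DModel m) 𝓘(ℝ, DModel m) φ y :=
    (mdifferentiable_chart hφ).mdifferentiableAt hy
  have h2 : HasMFDerivAt 𝓘(ℝ, DModel m) 𝓘(ℝ, ℝ) (modelCoord k) (φ y) (modelCoord k) :=
    (modelCoord k).hasMFDerivAt
  rw [dcoord, coord_eq, (h2.comp y h1.hasMFDerivAt).mfderiv]
  rfl

theorem mfderiv_coordVF (hφ : φ ∈ (doubleGroupoid m).maximalAtlas M) {y : M} (hy : y ∈ φ.source)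
    (k : Fin m ⊕ Fin m) :
    mfderiv 𝓘(ℝ, DModel m) 𝓘(ℝ, DModel m) φ y (coordVF φ k y) = modelBasis m k := by
  have h : (mfderiv 𝓘(ℝ, DModel m) 𝓘(ℝ, DModel m) φ y).IsInvertible :=
    ⟨(mdifferentiable_chart hφ).mfderiv hy, rfl⟩
  exact h.self_apply_inverse _

theorem dcoord_coordVF (hφ : φ ∈ (doubleGroupoid m).maximalAtlas M) {y : M} (hy : y ∈ φ.source)
    (k l : Fin m ⊕ Fin m) : dcoord φ k y (coordVF φ l y) = if k = l then 1 else 0 := by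
  rw [dcoord_apply hφ hy, ← modelCoord_modelBasis k l]
  exact congrArg (modelCoord k) (mfderiv_coordVF hφ hy l)

theorem tangent_ext (hφ : φ ∈ (doubleGroupoid m).maximalAtlas M) {y : M} (hy : y ∈ φ.source)
    {v w : TangentSpace 𝓘(ℝ, DModel m) y} (h : ∀ k, dcoord φ k y v = dcoord φ k y w) : v = w := by
  refine (mdifferentiable_chart hφ).mfderiv_injective hy (model_ext fun k => ?_)
  have := h k
  rwa [dcoord_apply hφ hy, dcoord_apply hφ hy] at this

theorem sum_dcoord_smul_coordVF (hφ : φ ∈ (doubleGroupoid m).maximalAtlas M) {y : M}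
    (hy : y ∈ φ.source) (v : TangentSpace 𝓘(ℝ, DModel m) y) :
    ∑ k, dcoord φ k y v • coordVF φ k y = v := by
  refine tangent_ext hφ hy fun l => ?_
  rw [map_sum]
  simp [dcoord_coordVF hφ hy]

theorem dcoord_sum_smul_coordVF (hφ : φ ∈ (doubleGroupoid m).maximalAtlas M) {y : M}
    (hy : y ∈ φ.source) (c : Fin m ⊕ Fin m → ℝ) (l) :
    dcoord φ l y (∑ k, c k • coordVF φ k y) = c l := by
  rw [map_sum]
  simp [dcoord_coordVF hφ hy]

/-- The coordinate differentials of two distinguished charts are related by matrices that are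
locally constant and inverse transposes of each other. -/
theorem dcoord_transition (hφ : φ ∈ (doubleGroupoid m).maximalAtlas M)
    (hψ : ψ ∈ (doubleGroupoid m).maximalAtlas M) {x : M} (hx : x ∈ φ.source) (hx' : x ∈ ψ.source) :
    ∃ α β : Matrix (Fin m) (Fin m) ℝ, α.transpose * β = 1 ∧ ∀ᶠ y in 𝓝 x,
      ∀ v : TangentSpace 𝓘(ℝ, DModel m) y,
        (∀ i, dcoord φ (Sum.inl i) y v = ∑ j, α i j * dcoord ψ (Sum.inl j) y v) ∧
        (∀ i, dcoord φ (Sum.inr i) y v = ∑ j, β i j * dcoord ψ (Sum.inr j) y v) := by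
  have hg := StructureGroupoid.compatible_of_mem_maximalAtlas hψ hφ
  obtain ⟨α, β, a, b, h, hz⟩ := hg.1 (ψ x) (by simp [hx, hx'])
  refine ⟨α, β, h, ?_⟩
  have hz' : ∀ᶠ z in 𝓝 (ψ x), φ (ψ.symm z) = (α.mulVec z.1 + a, β.mulVec z.2 + b) := hz
  -- The affine form is needed in a whole neighbourhood of each nearby point y, not just at y, since
  -- the transition is differentiated at y.
  have hc := (ψ.continuousAt hx').eventually hz'.eventually_nhds
  filter_upwards [hc, ψ.open_source.mem_nhds hx', φ.open_source.mem_nhds hx] with y hy hyψ hyφ v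
  set T : DModel m →L[ℝ] DModel m :=
    (LinearMap.toContinuousLinearMap ((Matrix.mulVecLin α).prodMap (Matrix.mulVecLin β)))
  have hφψ : φ =ᶠ[𝓝 y] (fun z => T z + (a, b)) ∘ ψ := by
    filter_upwards [(ψ.continuousAt hyψ).eventually hy, ψ.open_source.mem_nhds hyψ] with w hw hwψ
    rw [ψ.left_inv hwψ] at hw
    rw [hw]; rfl
  have hd : HasMFDerivAt 𝓘(ℝ, DModel m) 𝓘(ℝ, DModel m) (fun z => T z + (a, b)) (ψ y) T :=
    (T.hasFDerivAt.add_const _).hasMFDerivAt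
  have hm := (hd.comp y ((mdifferentiable_chart hψ).mdifferentiableAt hyψ).hasMFDerivAt).mfderiv
  have key : (mfderiv 𝓘(ℝ, DModel m) 𝓘(ℝ, DModel m) φ y v : DModel m) =
      T (mfderiv 𝓘(ℝ, DModel m) 𝓘(ℝ, DModel m) ψ y v) := by
    rw [hφψ.mfderiv_eq, hm]; rfl
  simp only [dcoord_apply hφ hyφ, dcoord_apply hψ hyψ]
  refine ⟨fun i => ?_, fun i => ?_⟩
  · have h (z : DModel m) : modelCoord (Sum.inl i) (T z) =
        ∑ j, α i j * modelCoord (Sum.inl j) z := rfl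
    exact (congrArg (modelCoord (Sum.inl i)) key).trans (h _)
  · have h (z : DModel m) : modelCoord (Sum.inr i) (T z) =
        ∑ j, β i j * modelCoord (Sum.inr j) z := rfl
    exact (congrArg (modelCoord (Sum.inr i)) key).trans (h _)

end Charts

end

/-! ### Differentials, partial derivatives and foliated functions -/

section

variable {m : ℕ} {M : Type*} [TopologicalSpace M] [ChartedSpace (DModel m) M]

/-- The differential of a function, as a linear form on the tangent space. -/
def dfun (f : M → ℝ) (x : M) : TangentSpace 𝓘(ℝ, DModel m) x →L[ℝ] ℝ :=
  mfderiv 𝓘(ℝ, DModel m) 𝓘(ℝ, ℝ) f x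

/-- The partial derivatives of a function with respect to the coordinates of a chart. -/
def pd (φ : OpenPartialHomeomorph M (DModel m)) (k : Fin m ⊕ Fin m) (f : M → ℝ) (x : M) : ℝ :=
  dfun f x (coordVF φ k x)

/-- A function is differentiable at a point of a manifold modelled on `DModel m`. -/
abbrev DiffAt (f : M → ℝ) (x : M) : Prop :=
  MDifferentiableAt 𝓘(ℝ, DModel m) 𝓘(ℝ, ℝ) f x

section dfun

variable {f g : M → ℝ} {x : M}

theorem dfun_congr (h : f =ᶠ[𝓝 x] g) :
    dfun (m := m) f x = dfun g x := h.mfderiv_eq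

theorem dfun_const (c : ℝ) : dfun (m := m) (fun _ : M => c) x = 0 := mfderiv_const

theorem dfun_add (hf : DiffAt (m := m) f x) (hg : DiffAt (m := m) g x) :
    dfun (m := m) (fun y => f y + g y) x = dfun f x + dfun g x :=
  (hf.hasMFDerivAt.add hg.hasMFDerivAt).mfderiv

theorem dfun_sub (hf : DiffAt (m := m) f x) (hg : DiffAt (m := m) g x) :
    dfun (m := m) (fun y => f y - g y) x = dfun f x - dfun g x :=
  (hf.hasMFDerivAt.sub hg.hasMFDerivAt).mfderiv

theorem dfun_mul (hf : DiffAt (m := m) f x) (hg : DiffAt (m := m) g x) :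
    dfun (m := m) (fun y => f y * g y) x = f x • dfun g x + g x • dfun f x :=
  (hf.hasMFDerivAt.mul hg.hasMFDerivAt).mfderiv

theorem dfun_const_mul (c : ℝ) (hf : DiffAt (m := m) f x) :
    dfun (m := m) (fun y => c * f y) x = c • dfun f x := by
  rw [dfun_mul mdifferentiableAt_const hf, dfun_const]
  simp

theorem diffAt_sum {ι : Type*} {s : Finset ι} {f : ι → M → ℝ}
    (h : ∀ i ∈ s, DiffAt (m := m) (f i) x) : DiffAt (m := m) (fun y => ∑ i ∈ s, f i y) x := by
  classical
  induction s using Finset.induction_on with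
  | empty => simpa using mdifferentiableAt_const
  | insert a s ha ih =>
    simp only [Finset.sum_insert ha]
    exact (h a (by simp)).add (ih fun i hi => h i (by simp [hi]))

theorem dfun_sum {ι : Type*} {s : Finset ι} {f : ι → M → ℝ}
    (h : ∀ i ∈ s, DiffAt (m := m) (f i) x) :
    dfun (m := m) (fun y => ∑ i ∈ s, f i y) x = ∑ i ∈ s, dfun (f i) x := by
  classical
  induction s using Finset.induction_on with
  | empty => simpa using dfun_const (m := m) (M := M) (x := x) 0
  | insert a s ha ih =>
    simp only [Finset.sum_insert ha]
    rw [dfun_add (h a (by simp)) (diffAt_sum fun i hi => h i (by simp [hi])),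
      ih fun i hi => h i (by simp [hi])]

end dfun

section Charts

variable [HasGroupoid M (doubleGroupoid m)] {φ ψ : OpenPartialHomeomorph M (DModel m)}

theorem dfun_eq_sum (hφ : φ ∈ (doubleGroupoid m).maximalAtlas M) {x : M} (hx : x ∈ φ.source)
    (f : M → ℝ) (v : TangentSpace 𝓘(ℝ, DModel m) x) :
    dfun f x v = ∑ k, dcoord φ k x v * pd φ k f x := by
  conv_lhs => rw [← sum_dcoord_smul_coordVF hφ hx v, map_sum]
  simp [pd]

/-- The chain rule for f = (f ∘ φ⁻¹) ∘ φ, as dφ sends the coordinate field to a constant basis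
vector. Calculus on the model space enters through this formula. -/
theorem pd_eq_fderiv (hφ : φ ∈ (doubleGroupoid m).maximalAtlas M) {x : M} (hx : x ∈ φ.source)
    {f : M → ℝ} (hf : DiffAt (m := m) f x) (k : Fin m ⊕ Fin m) :
    pd φ k f x = fderiv ℝ (f ∘ φ.symm) (φ x) (modelBasis m k) := by
  have hs := (mdifferentiable_chart hφ).mdifferentiableAt_symm (φ.map_source hx)
  have hf' : DiffAt (m := m) f (φ.symm (φ x)) := by rwa [φ.left_inv hx]
  have hF := (hf'.comp (φ x) hs).hasMFDerivAt.hasFDerivAt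
  have he : f =ᶠ[𝓝 x] (f ∘ φ.symm) ∘ φ := by
    filter_upwards [φ.open_source.mem_nhds hx] with y hy
    simp [φ.left_inv hy]
  have h := (hF.differentiableAt.hasFDerivAt.hasMFDerivAt.comp x
    ((mdifferentiable_chart hφ).mdifferentiableAt hx).hasMFDerivAt).mfderiv
  rw [pd, dfun_congr he]
  refine (DFunLike.congr_fun h (coordVF φ k x)).trans ?_
  exact congrArg (fderiv ℝ (f ∘ φ.symm) (φ x)) (mfderiv_coordVF hφ hx k)

/-- Distinguished transitions do not mix the dx with the dx̃, so the vanishing of all dx^i does not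
depend on the chart. -/
theorem mem_foliationLt_iff (hφ : φ ∈ (doubleGroupoid m).maximalAtlas M) {x : M}
    (hx : x ∈ φ.source) {v : TangentSpace 𝓘(ℝ, DModel m) x} :
    v ∈ foliationLt m M x ↔ ∀ i, dcoord φ (Sum.inl i) x v = 0 := by
  have h0 : v ∈ foliationLt m M x ↔
      ∀ i, dcoord (chartAt (DModel m) x) (Sum.inl i) x v = 0 := by
    simp only [foliationLt, Submodule.mem_iInf, LinearMap.mem_ker]
    rfl
  have hc := chart_mem_doubleAtlas (m := m) x
  have hxc := mem_chart_source (DModel m) x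
  rw [h0]
  constructor
  · intro h i
    obtain ⟨α, β, -, hz⟩ := dcoord_transition hφ hc hx hxc
    rw [(hz.self_of_nhds v).1 i]
    simp [h]
  · intro h i
    obtain ⟨α, β, -, hz⟩ := dcoord_transition hc hφ hxc hx
    rw [(hz.self_of_nhds v).1 i]
    simp [h]

theorem coordVF_inr_mem (hφ : φ ∈ (doubleGroupoid m).maximalAtlas M) {x : M}
    (hx : x ∈ φ.source) (i : Fin m) : coordVF φ (Sum.inr i) x ∈ foliationLt m M x := by
  rw [mem_foliationLt_iff hφ hx]
  intro j
  simp [dcoord_coordVF hφ hx]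

end Charts

section FoliatedFun

variable {U : Set M} {f g : M → ℝ}

local notation "Fol" => IsFoliatedFun (foliationLt m M)

theorem IsFoliatedFun.diffAt (h : Fol U f) (hU : IsOpen U) {x : M} (hx : x ∈ U) :
    DiffAt (m := m) f x :=
  (h.1.contMDiffAt (hU.mem_nhds hx)).mdifferentiableAt (by simp)

theorem isFoliatedFun_iff : Fol U f ↔ ContMDiffOn 𝓘(ℝ, DModel m) 𝓘(ℝ, ℝ) ∞ f U ∧
    ∀ x ∈ U, ∀ v ∈ foliationLt m M x, dfun f x v = 0 := Iff.rfl

theorem IsFoliatedFun.mono (h : Fol U f) {V : Set M} (hV : V ⊆ U) : Fol V f :=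
  ⟨h.1.mono hV, fun x hx => h.2 x (hV hx)⟩

theorem IsFoliatedFun.congr (h : Fol U f) (hU : IsOpen U) (hfg : ∀ x ∈ U, g x = f x) : Fol U g := by
  refine isFoliatedFun_iff.2 ⟨h.1.congr hfg, fun x hx v hv => ?_⟩
  rw [dfun_congr (Filter.eventuallyEq_of_mem (hU.mem_nhds hx) hfg)]
  exact h.2 x hx v hv

theorem isFoliatedFun_of_forall (h : ∀ x ∈ U, ∃ V, IsOpen V ∧ x ∈ V ∧ Fol (U ∩ V) f) : Fol U f := by
  refine ⟨fun x hx => ?_, fun x hx => ?_⟩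
  · obtain ⟨V, hV, hxV, hf⟩ := h x hx
    exact (contMDiffWithinAt_inter (hV.mem_nhds hxV)).1 (hf.1 x ⟨hx, hxV⟩)
  · obtain ⟨V, hV, hxV, hf⟩ := h x hx
    exact hf.2 x ⟨hx, hxV⟩

theorem isFoliatedFun_const (c : ℝ) : Fol U (fun _ => c) := by
  refine isFoliatedFun_iff.2 ⟨contMDiffOn_const, fun x _ v _ => ?_⟩
  rw [dfun_const]; rfl

theorem IsFoliatedFun.add (hf : Fol U f) (hg : Fol U g) (hU : IsOpen U) :
    Fol U (fun y => f y + g y) := by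
  refine isFoliatedFun_iff.2 ⟨hf.1.add hg.1, fun x hx v hv => ?_⟩
  rw [dfun_add (hf.diffAt hU hx) (hg.diffAt hU hx), add_apply, (isFoliatedFun_iff.1 hf).2 x hx v hv,
    (isFoliatedFun_iff.1 hg).2 x hx v hv, add_zero]

theorem IsFoliatedFun.mul (hf : Fol U f) (hg : Fol U g) (hU : IsOpen U) :
    Fol U (fun y => f y * g y) := by
  refine isFoliatedFun_iff.2 ⟨hf.1.mul hg.1, fun x hx v hv => ?_⟩
  rw [dfun_mul (hf.diffAt hU hx) (hg.diffAt hU hx)]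
  simp [(isFoliatedFun_iff.1 hf).2 x hx v hv, (isFoliatedFun_iff.1 hg).2 x hx v hv]

theorem IsFoliatedFun.sub (hf : Fol U f) (hg : Fol U g) (hU : IsOpen U) :
    Fol U (fun y => f y - g y) := by
  have := hf.add ((isFoliatedFun_const (-1)).mul hg hU) hU
  exact this.congr hU fun x _ => by ring

theorem IsFoliatedFun.sum {ι : Type*} {s : Finset ι} {f : ι → M → ℝ}
    (hf : ∀ i ∈ s, Fol U (f i)) (hU : IsOpen U) : Fol U (fun y => ∑ i ∈ s, f i y) := by
  classical
  induction s using Finset.induction_on with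
  | empty => simpa using isFoliatedFun_const (U := U) 0
  | insert a s ha ih =>
    simp only [Finset.sum_insert ha]
    exact (hf a (by simp)).add (ih fun i hi => hf i (by simp [hi])) hU

variable [HasGroupoid M (doubleGroupoid m)] {φ ψ : OpenPartialHomeomorph M (DModel m)}

theorem IsFoliatedFun.pd_inr (hf : Fol U f) (hφ : φ ∈ (doubleGroupoid m).maximalAtlas M) {x : M}
    (hxU : x ∈ U) (hx : x ∈ φ.source) (i : Fin m) : pd φ (Sum.inr i) f x = 0 :=
  hf.2 x hxU _ (coordVF_inr_mem hφ hx i)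

theorem IsFoliatedFun.dfun_eq (hf : Fol U f) (hφ : φ ∈ (doubleGroupoid m).maximalAtlas M) {x : M}
    (hxU : x ∈ U) (hx : x ∈ φ.source) (v : TangentSpace 𝓘(ℝ, DModel m) x) :
    dfun f x v = ∑ i, dcoord φ (Sum.inl i) x v * pd φ (Sum.inl i) f x := by
  rw [dfun_eq_sum hφ hx, Fintype.sum_sum_type]
  simp [hf.pd_inr hφ hxU hx]

theorem contDiffOn_comp_symm (hf : ContMDiffOn 𝓘(ℝ, DModel m) 𝓘(ℝ, ℝ) ∞ f U)
    (hφ : φ ∈ (doubleGroupoid m).maximalAtlas M) :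
    ContDiffOn ℝ ∞ (f ∘ φ.symm) (φ.target ∩ φ.symm ⁻¹' U) := by
  rw [← contMDiffOn_iff_contDiffOn]
  exact hf.comp ((contMDiffOn_symm_of_mem_maximalAtlas (mem_smoothAtlas hφ ∞)).mono
    Set.inter_subset_left) fun x hx => hx.2

theorem eqOn_pd_symm (hU : IsOpen U) (hf : ContMDiffOn 𝓘(ℝ, DModel m) 𝓘(ℝ, ℝ) ∞ f U)
    (hφ : φ ∈ (doubleGroupoid m).maximalAtlas M) (k : Fin m ⊕ Fin m) :
    ∀ z ∈ φ.target ∩ φ.symm ⁻¹' U,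
      (pd φ k f ∘ φ.symm) z = fderiv ℝ (f ∘ φ.symm) z (modelBasis m k) := by
  rintro z ⟨hz, hzU⟩
  rw [Function.comp_apply, pd_eq_fderiv hφ (φ.map_target hz)
    ((hf.contMDiffAt (hU.mem_nhds hzU)).mdifferentiableAt (by simp)), φ.right_inv hz]

theorem contMDiffOn_pd (hU : IsOpen U) (hf : ContMDiffOn 𝓘(ℝ, DModel m) 𝓘(ℝ, ℝ) ∞ f U)
    (hUφ : U ⊆ φ.source) (hφ : φ ∈ (doubleGroupoid m).maximalAtlas M) (k : Fin m ⊕ Fin m) :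
    ContMDiffOn 𝓘(ℝ, DModel m) 𝓘(ℝ, ℝ) ∞ (pd φ k f) U := by
  have hW : IsOpen (φ.target ∩ φ.symm ⁻¹' U) := φ.isOpen_inter_preimage_symm hU
  have h1 : ContDiffOn ℝ ∞ (fun z => fderiv ℝ (f ∘ φ.symm) z (modelBasis m k))
      (φ.target ∩ φ.symm ⁻¹' U) :=
    ((contDiffOn_comp_symm hf hφ).fderiv_of_isOpen hW (by simp)).clm_apply contDiffOn_const
  have h2 := h1.contMDiffOn.comp ((contMDiffOn_of_mem_maximalAtlas (mem_smoothAtlas hφ ∞)).mono hUφ)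
    (fun x hx => ⟨φ.map_source (hUφ hx), by simpa [φ.left_inv (hUφ hx)] using hx⟩)
  refine h2.congr fun x hx => ?_
  exact pd_eq_fderiv hφ (hUφ hx) ((hf.contMDiffAt (hU.mem_nhds hx)).mdifferentiableAt (by simp)) k

/-- Schwarz's theorem for f ∘ φ⁻¹: both sides are its second derivative on two constant vectors. -/
theorem pd_comm (hU : IsOpen U) (hf : ContMDiffOn 𝓘(ℝ, DModel m) 𝓘(ℝ, ℝ) ∞ f U)
    (hUφ : U ⊆ φ.source) (hφ : φ ∈ (doubleGroupoid m).maximalAtlas M) (k l : Fin m ⊕ Fin m)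
    {x : M} (hx : x ∈ U) : pd φ k (pd φ l f) x = pd φ l (pd φ k f) x := by
  have hW : IsOpen (φ.target ∩ φ.symm ⁻¹' U) := φ.isOpen_inter_preimage_symm hU
  have hxW : φ x ∈ φ.target ∩ φ.symm ⁻¹' U :=
    ⟨φ.map_source (hUφ hx), by simpa [φ.left_inv (hUφ hx)] using hx⟩
  have hc := contDiffOn_comp_symm hf hφ
  have hd := (hc.fderiv_of_isOpen (m := ∞) hW (by simp)).contDiffAt (hW.mem_nhds hxW)
  have hs := (hc.contDiffAt (hW.mem_nhds hxW)).isSymmSndFDerivAt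
    (by simpa using WithTop.coe_le_coe.2 (le_top (a := (2 : ℕ∞))))
  have key (k l) : pd φ k (pd φ l f) x =
      fderiv ℝ (fderiv ℝ (f ∘ φ.symm)) (φ x) (modelBasis m k) (modelBasis m l) := by
    rw [pd_eq_fderiv hφ (hUφ hx) (((contMDiffOn_pd hU hf hUφ hφ l).contMDiffAt
      (hU.mem_nhds hx)).mdifferentiableAt (by simp)),
      (Filter.eventuallyEq_of_mem (hW.mem_nhds hxW) (eqOn_pd_symm hU hf hφ l)).fderiv_eq,
      fderiv_clm_apply (hd.differentiableAt (by simp)) (differentiableAt_const _)]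
    simp
  rw [key, key, hs.eq]

/-- ∂/∂x̃_j commutes with ∂/∂x^i and kills f in a neighbourhood, so it kills ∂f/∂x^i. -/
theorem IsFoliatedFun.pd (hf : Fol U f) (hU : IsOpen U) (hUφ : U ⊆ φ.source)
    (hφ : φ ∈ (doubleGroupoid m).maximalAtlas M) (i : Fin m) : Fol U (pd φ (Sum.inl i) f) := by
  refine isFoliatedFun_iff.2 ⟨contMDiffOn_pd hU hf.1 hUφ hφ _, fun x hx v hv => ?_⟩
  rw [dfun_eq_sum hφ (hUφ hx), Fintype.sum_sum_type]
  have h0 (j : Fin m) : DoubleField.pd φ (Sum.inr j) (DoubleField.pd φ (Sum.inl i) f) x = 0 := by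
    rw [pd_comm hU hf.1 hUφ hφ _ _ hx]
    have : DoubleField.pd φ (Sum.inr j) f =ᶠ[𝓝 x] fun _ => 0 :=
      Filter.eventuallyEq_of_mem (hU.mem_nhds hx) fun y hy => hf.pd_inr hφ hy (hUφ hy) j
    rw [DoubleField.pd, dfun_congr this, dfun_const]; rfl
  simp [h0, (mem_foliationLt_iff hφ (hUφ hx)).1 hv]

end FoliatedFun

end

/-! ### Metric, anchor, ∂, connection and bracket in an arbitrary distinguished chart -/

section

variable {m : ℕ} {M : Type*} [TopologicalSpace M] [ChartedSpace (DModel m) M]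
  [HasGroupoid M (doubleGroupoid m)] {φ ψ : OpenPartialHomeomorph M (DModel m)}

section Tensors

variable {x : M}

theorem gammaMetric_chartAt (v w : TangentSpace 𝓘(ℝ, DModel m) x) :
    gammaMetric m M x v w = ∑ i,
      (dcoord (chartAt (DModel m) x) (Sum.inl i) x v * dcoord (chartAt (DModel m) x) (Sum.inr i) x w +
      dcoord (chartAt (DModel m) x) (Sum.inr i) x v *
        dcoord (chartAt (DModel m) x) (Sum.inl i) x w) := by
  simp [gammaMetric, LinearMap.sum_apply]

/-- Moving α across the dot product gives a · (ᵗα β) b. -/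
theorem sum_mulVec_mul_mulVec {α β : Matrix (Fin m) (Fin m) ℝ} (h : α.transpose * β = 1)
    (a b : Fin m → ℝ) :
    ∑ i, (∑ j, α i j * a j) * (∑ j, β i j * b j) = ∑ j, a j * b j := by
  have := Matrix.dotProduct_mulVec (α.mulVec a) β b
  rw [Matrix.vecMul_mulVec, h, Matrix.vecMul_one] at this
  exact this

/-- Each product pairs a dx, which changes by α, with a dx̃, which changes by β; ᵗα β = 1 cancels
them. -/
theorem gammaMetric_apply (hφ : φ ∈ (doubleGroupoid m).maximalAtlas M) (hx : x ∈ φ.source)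
    (v w : TangentSpace 𝓘(ℝ, DModel m) x) :
    gammaMetric m M x v w = ∑ i, (dcoord φ (Sum.inl i) x v * dcoord φ (Sum.inr i) x w +
      dcoord φ (Sum.inr i) x v * dcoord φ (Sum.inl i) x w) := by
  obtain ⟨α, β, h, hz⟩ := dcoord_transition (chart_mem_doubleAtlas x) hφ (mem_chart_source _ x) hx
  have hz := hz.self_of_nhds
  rw [gammaMetric_chartAt, Finset.sum_add_distrib, Finset.sum_add_distrib]
  simp only [(hz v).1, (hz w).1, (hz v).2, (hz w).2]
  rw [sum_mulVec_mul_mulVec h]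
  congr 1
  -- In the second sum the factors come in the opposite order; the α-factor is brought to the front.
  simp only [mul_comm _ (∑ j, α _ j * _)]
  rw [sum_mulVec_mul_mulVec h]
  simp only [mul_comm]

theorem gammaMetric_symm (v w : TangentSpace 𝓘(ℝ, DModel m) x) :
    gammaMetric m M x v w = gammaMetric m M x w v := by
  simp only [gammaMetric_chartAt]
  exact Finset.sum_congr rfl fun i _ => by ring

theorem gammaMetric_coordVF_inl (hφ : φ ∈ (doubleGroupoid m).maximalAtlas M) (hx : x ∈ φ.source)
    (v : TangentSpace 𝓘(ℝ, DModel m) x) (i : Fin m) :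
    gammaMetric m M x v (coordVF φ (Sum.inl i) x) = dcoord φ (Sum.inr i) x v := by
  simp [gammaMetric_apply hφ hx, dcoord_coordVF hφ hx]

theorem gammaMetric_coordVF_inr (hφ : φ ∈ (doubleGroupoid m).maximalAtlas M) (hx : x ∈ φ.source)
    (v : TangentSpace 𝓘(ℝ, DModel m) x) (i : Fin m) :
    gammaMetric m M x v (coordVF φ (Sum.inr i) x) = dcoord φ (Sum.inl i) x v := by
  simp [gammaMetric_apply hφ hx, dcoord_coordVF hφ hx]

/-- `Function.invFun` is a right inverse on the range, so it suffices that γ represents every linear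
form. -/
theorem gammaMetric_invFun (ℓ : TangentSpace 𝓘(ℝ, DModel m) x →ₗ[ℝ] ℝ) :
    gammaMetric m M x (Function.invFun (gammaMetric m M x) ℓ) = ℓ := by
  have hφ := chart_mem_doubleAtlas (m := m) x
  have hx := mem_chart_source (DModel m) x
  -- γ pairs ∂/∂x^i with ∂/∂x̃_i, so the representing vector has the coefficients of ℓ with the two
  -- halves exchanged.
  refine Function.invFun_eq (f := gammaMetric m M x) ⟨∑ k, Sum.elim
    (fun i => ℓ (coordVF (chartAt _ x) (Sum.inr i) x))
    (fun i => ℓ (coordVF (chartAt _ x) (Sum.inl i) x)) k • coordVF (chartAt _ x) k x, ?_⟩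
  ext w
  rw [gammaMetric_apply hφ hx]
  simp only [dcoord_sum_smul_coordVF hφ hx]
  conv_rhs => rw [← sum_dcoord_smul_coordVF hφ hx w]
  rw [map_sum, Fintype.sum_sum_type, ← Finset.sum_add_distrib]
  refine Finset.sum_congr rfl fun i _ => ?_
  simp only [Sum.elim_inl, Sum.elim_inr, map_smul, smul_eq_mul]
  ring

theorem dcoord_inl_invFun (hφ : φ ∈ (doubleGroupoid m).maximalAtlas M) (hx : x ∈ φ.source)
    (ℓ : TangentSpace 𝓘(ℝ, DModel m) x →ₗ[ℝ] ℝ) (i : Fin m) :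
    dcoord φ (Sum.inl i) x (Function.invFun (gammaMetric m M x) ℓ) =
      ℓ (coordVF φ (Sum.inr i) x) := by
  rw [← gammaMetric_coordVF_inr hφ hx, gammaMetric_invFun]

theorem dcoord_inr_invFun (hφ : φ ∈ (doubleGroupoid m).maximalAtlas M) (hx : x ∈ φ.source)
    (ℓ : TangentSpace 𝓘(ℝ, DModel m) x →ₗ[ℝ] ℝ) (i : Fin m) :
    dcoord φ (Sum.inr i) x (Function.invFun (gammaMetric m M x) ℓ) =
      ℓ (coordVF φ (Sum.inl i) x) := by
  rw [← gammaMetric_coordVF_inl hφ hx, gammaMetric_invFun]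

/-- A vector differs from its projection to L by an element of L̃. -/
theorem anchorL_apply (v : TangentSpace 𝓘(ℝ, DModel m) x) :
    anchorL m M x v = (foliationLt m M x).mkQ v := by
  have hφ := chart_mem_doubleAtlas (m := m) x
  have hx := mem_chart_source (DModel m) x
  change (foliationLt m M x).mkQ (prL m M x v) = _
  rw [← sub_eq_zero, ← map_sub, Submodule.mkQ_apply, Submodule.Quotient.mk_eq_zero,
    mem_foliationLt_iff hφ hx]
  intro i
  rw [map_sub, prL, LinearMap.sum_apply, map_sum]
  simp [dcoord_coordVF hφ hx]

/-- Being foliated at x selects the genuine branch of `transDiff` rather than its default value 0.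
-/
theorem transDiff_mkQ {U : Set M} {f : M → ℝ} (hf : IsFoliatedFun (foliationLt m M) U f)
    (hx : x ∈ U) (v : TangentSpace 𝓘(ℝ, DModel m) x) :
    transDiff (foliationLt m M) f x ((foliationLt m M x).mkQ v) = dfun f x v := by
  have h : foliationLt m M x ≤ LinearMap.ker (dfun (m := m) f x).toLinearMap :=
    fun v hv => hf.2 x hx v hv
  have : transDiff (foliationLt m M) f x =
      (foliationLt m M x).liftQ (dfun (m := m) f x).toLinearMap h := dif_pos h
  rw [this]
  rfl

theorem transDiff_anchorL {U : Set M} {f : M → ℝ} (hf : IsFoliatedFun (foliationLt m M) U f)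
    (hx : x ∈ U) (v : TangentSpace 𝓘(ℝ, DModel m) x) :
    transDiff (foliationLt m M) f x (anchorL m M x v) = dfun f x v := by
  rw [anchorL_apply, transDiff_mkQ hf hx]

theorem dcoord_inl_transPartial {U : Set M} {f : M → ℝ}
    (hf : IsFoliatedFun (foliationLt m M) U f) (hxU : x ∈ U)
    (hφ : φ ∈ (doubleGroupoid m).maximalAtlas M) (hx : x ∈ φ.source) (i : Fin m) :
    dcoord φ (Sum.inl i) x
      (transPartial (foliationLt m M) (gammaMetric m M) (anchorL m M) f x) = 0 := by
  rw [transPartial, map_smul, dcoord_inl_invFun hφ hx, LinearMap.comp_apply,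
    transDiff_anchorL hf hxU]
  have := hf.pd_inr hφ hxU hx i
  rw [pd] at this
  rw [this, smul_zero]

theorem dcoord_inr_transPartial {U : Set M} {f : M → ℝ}
    (hf : IsFoliatedFun (foliationLt m M) U f) (hxU : x ∈ U)
    (hφ : φ ∈ (doubleGroupoid m).maximalAtlas M) (hx : x ∈ φ.source) (i : Fin m) :
    dcoord φ (Sum.inr i) x
      (transPartial (foliationLt m M) (gammaMetric m M) (anchorL m M) f x) =
      1 / 2 * pd φ (Sum.inl i) f x := by
  rw [transPartial, map_smul, dcoord_inr_invFun hφ hx, LinearMap.comp_apply,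
    transDiff_anchorL hf hxU]
  rfl

end Tensors

section Sections

/-- The components of a vector field with respect to a chart. -/
def comp (φ : OpenPartialHomeomorph M (DModel m)) (k : Fin m ⊕ Fin m)
    (X : ∀ x : M, TangentSpace 𝓘(ℝ, DModel m) x) (y : M) : ℝ :=
  dcoord φ k y (X y)

/-- Strongly foliated vector fields. -/
abbrev IsStrFoliated (U : Set M) (s : ∀ x : M, TangentSpace 𝓘(ℝ, DModel m) x) : Prop :=
  IsFoliatedSec (foliationLt m M) (distinguishedFrames m M) U s

variable {U : Set M} {s t : ∀ x : M, TangentSpace 𝓘(ℝ, DModel m) x} {x : M}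

theorem IsFoliatedSec.comp (hs : IsStrFoliated U s) (hU : IsOpen U)
    (hφ : φ ∈ (doubleGroupoid m).maximalAtlas M) (k : Fin m ⊕ Fin m) :
    IsFoliatedFun (foliationLt m M) (U ∩ φ.source) (comp φ k s) := by
  obtain ⟨ξ, hξ, hs'⟩ := hs (φ.source, coordVF φ) ⟨φ, hφ, rfl⟩
  refine (hξ k).congr (hU.inter φ.open_source) fun y hy => ?_
  rw [DoubleField.comp, hs' y hy]
  exact dcoord_sum_smul_coordVF hφ hy.2 (fun k => ξ k y) k

theorem isStrFoliated_of_comp (h : ∀ φ ∈ (doubleGroupoid m).maximalAtlas M, ∀ k,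
    IsFoliatedFun (foliationLt m M) (U ∩ φ.source) (comp φ k s)) : IsStrFoliated U s := by
  rintro _ ⟨φ, hφ, rfl⟩
  exact ⟨fun k => comp φ k s, h φ hφ, fun y hy => (sum_dcoord_smul_coordVF hφ hy.2 (s y)).symm⟩

/-- The definition differentiates components in the preferred chart at x. The transition matrices
are constant near x, so no derivative of them appears and the same formula holds in every
distinguished chart. -/
theorem dcoord_nabla0 (hφ : φ ∈ (doubleGroupoid m).maximalAtlas M) (hx : x ∈ φ.source)
    (hs : ∀ k, DiffAt (m := m) (comp (chartAt (DModel m) x) k s) x) (k : Fin m ⊕ Fin m)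
    (v : TangentSpace 𝓘(ℝ, DModel m) x) :
    dcoord φ k x (nabla0 s x v) = dfun (comp φ k s) x v := by
  have hψ := chart_mem_doubleAtlas (m := m) x
  have hxψ := mem_chart_source (DModel m) x
  have h0 (l : Fin m ⊕ Fin m) : dcoord (chartAt (DModel m) x) l x (nabla0 s x v) =
      dfun (comp (chartAt (DModel m) x) l s) x v := by
    rw [nabla0, sum_apply]
    exact dcoord_sum_smul_coordVF hψ hxψ (fun k => dfun (comp (chartAt (DModel m) x) k s) x v) l
  obtain ⟨α, β, -, hz⟩ := dcoord_transition hφ hψ hx hxψ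
  have aux (c : Fin m → ℝ) (e : Fin m → Fin m ⊕ Fin m) :
      dfun (m := m) (fun y => ∑ j, c j * comp (chartAt (DModel m) x) (e j) s y) x v =
        ∑ j, c j * dfun (comp (chartAt (DModel m) x) (e j) s) x v := by
    rw [dfun_sum (f := fun j y => c j * comp (chartAt (DModel m) x) (e j) s y)
      fun j _ => mdifferentiableAt_const.mul (hs _), sum_apply]
    refine Finset.sum_congr rfl fun j _ => ?_
    rw [dfun_const_mul _ (hs _)]; rfl
  rcases k with i | i
  · rw [(hz.self_of_nhds _).1]
    simp only [h0]
    rw [← aux]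
    exact (DFunLike.congr_fun (dfun_congr (hz.mono fun y hy => (hy (s y)).1 i)) v).symm
  · rw [(hz.self_of_nhds _).2]
    simp only [h0]
    rw [← aux]
    exact (DFunLike.congr_fun (dfun_congr (hz.mono fun y hy => (hy (s y)).2 i)) v).symm

theorem IsFoliatedSec.diffAt_comp (hs : IsStrFoliated U s) (hU : IsOpen U) (hxU : x ∈ U)
    (hφ : φ ∈ (doubleGroupoid m).maximalAtlas M) (hx : x ∈ φ.source) (k : Fin m ⊕ Fin m) :
    DiffAt (m := m) (DoubleField.comp φ k s) x :=
  (hs.comp hU hφ k).diffAt (hU.inter φ.open_source) ⟨hxU, hx⟩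

theorem IsFoliatedSec.dcoord_nabla0 (hs : IsStrFoliated U s) (hU : IsOpen U) (hxU : x ∈ U)
    (hφ : φ ∈ (doubleGroupoid m).maximalAtlas M) (hx : x ∈ φ.source) (k : Fin m ⊕ Fin m)
    (v : TangentSpace 𝓘(ℝ, DModel m) x) :
    dcoord φ k x (nabla0 s x v) =
      ∑ i, dcoord φ (Sum.inl i) x v * pd φ (Sum.inl i) (DoubleField.comp φ k s) x := by
  rw [DoubleField.dcoord_nabla0 hφ hx fun k => hs.diffAt_comp hU hxU (chart_mem_doubleAtlas x)
    (mem_chart_source _ x) k, (hs.comp hU hφ k).dfun_eq hφ ⟨hxU, hx⟩ hx]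

/-- The wedge term does not contribute: its dx^i-component is its pairing with ∂/∂x̃_i, and strongly
foliated fields are ∇⁰-parallel in that direction. -/
theorem comp_bracket0_inl (hs : IsStrFoliated U s) (ht : IsStrFoliated U t) (hU : IsOpen U)
    (hφ : φ ∈ (doubleGroupoid m).maximalAtlas M) (hxU : x ∈ U) (hx : x ∈ φ.source) (i : Fin m) :
    comp φ (Sum.inl i) (bracket0 s t) x =
      ∑ j, (comp φ (Sum.inl j) s x * pd φ (Sum.inl j) (comp φ (Sum.inl i) t) x -
        comp φ (Sum.inl j) t x * pd φ (Sum.inl j) (comp φ (Sum.inl i) s) x) := by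
  have hn {r : ∀ x : M, TangentSpace 𝓘(ℝ, DModel m) x} (hr : IsStrFoliated U r) (i : Fin m) :
      nabla0 r x (coordVF φ (Sum.inr i) x) = 0 := by
    refine tangent_ext hφ hx fun k => ?_
    rw [hr.dcoord_nabla0 hU hxU hφ hx]
    simp [dcoord_coordVF hφ hx]
  rw [comp, bracket0, map_sub, map_sub, hs.dcoord_nabla0 hU hxU hφ hx,
    ht.dcoord_nabla0 hU hxU hφ hx, wedge0, dcoord_inl_invFun hφ hx, Finset.sum_sub_distrib]
  simp [hn hs, hn ht, comp]

/-- The terms with factor 1/2 are the wedge term, whose dx̃_i-component is its pairing with ∂/∂x^i.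
-/
theorem comp_bracket0_inr (hs : IsStrFoliated U s) (ht : IsStrFoliated U t) (hU : IsOpen U)
    (hφ : φ ∈ (doubleGroupoid m).maximalAtlas M) (hxU : x ∈ U) (hx : x ∈ φ.source) (i : Fin m) :
    comp φ (Sum.inr i) (bracket0 s t) x =
      ∑ j, (comp φ (Sum.inl j) s x * pd φ (Sum.inl j) (comp φ (Sum.inr i) t) x -
        comp φ (Sum.inl j) t x * pd φ (Sum.inl j) (comp φ (Sum.inr i) s) x -
        1 / 2 * (comp φ (Sum.inl j) s x * pd φ (Sum.inl i) (comp φ (Sum.inr j) t) x +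
          comp φ (Sum.inr j) s x * pd φ (Sum.inl i) (comp φ (Sum.inl j) t) x -
          comp φ (Sum.inl j) t x * pd φ (Sum.inl i) (comp φ (Sum.inr j) s) x -
          comp φ (Sum.inr j) t x * pd φ (Sum.inl i) (comp φ (Sum.inl j) s) x)) := by
  have hn {r : ∀ x : M, TangentSpace 𝓘(ℝ, DModel m) x} (hr : IsStrFoliated U r) (i : Fin m)
      (k : Fin m ⊕ Fin m) :
      dcoord φ k x (nabla0 r x (coordVF φ (Sum.inl i) x)) = pd φ (Sum.inl i) (comp φ k r) x := by
    rw [hr.dcoord_nabla0 hU hxU hφ hx]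
    simp [dcoord_coordVF hφ hx]
  rw [comp, bracket0, map_sub, map_sub, hs.dcoord_nabla0 hU hxU hφ hx,
    ht.dcoord_nabla0 hU hxU hφ hx, wedge0, dcoord_inr_invFun hφ hx]
  simp only [LinearMap.smul_apply, LinearMap.sub_apply, LinearMap.comp_apply,
    ContinuousLinearMap.coe_coe, smul_eq_mul, gammaMetric_apply hφ hx, hn hs, hn ht]
  rw [← Finset.sum_sub_distrib, ← Finset.sum_sub_distrib, Finset.mul_sum, ← Finset.sum_sub_distrib]
  refine Finset.sum_congr rfl fun j _ => ?_
  simp only [comp]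
  ring

theorem nabla0_congr (h : ∀ᶠ y in 𝓝 x, s y = t y) : nabla0 s x = nabla0 t x := by
  rw [nabla0, nabla0]
  refine Finset.sum_congr rfl fun k _ => ?_
  congr 1
  exact dfun_congr (h.mono fun y hy => congrArg (dcoord _ k y) hy)

theorem bracket0_congr {s' t' : ∀ x : M, TangentSpace 𝓘(ℝ, DModel m) x}
    (hs : ∀ᶠ y in 𝓝 x, s y = s' y) (ht : ∀ᶠ y in 𝓝 x, t y = t' y) :
    bracket0 s t x = bracket0 s' t' x := by
  simp only [bracket0, wedge0, nabla0_congr hs, nabla0_congr ht, hs.self_of_nhds, ht.self_of_nhds]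

end Sections

end

/-! ### Smooth vector fields and the Lie bracket in coordinates -/

section

variable {m : ℕ} {M : Type*} [TopologicalSpace M] [ChartedSpace (DModel m) M]
  [HasGroupoid M (doubleGroupoid m)] {φ ψ : OpenPartialHomeomorph M (DModel m)}

section VectorFields

variable {U : Set M} {X Y : ∀ x : M, TangentSpace 𝓘(ℝ, DModel m) x} {x : M}

/-- A coordinate field is the pullback by the chart of a constant field. -/
theorem isSmoothVF_coordVF (hφ : φ ∈ (doubleGroupoid m).maximalAtlas M) (k : Fin m ⊕ Fin m) :
    IsSmoothVF φ.source (coordVF φ k) := by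
  intro x hx
  have hV : ContMDiffAt 𝓘(ℝ, DModel m) (𝓘(ℝ, DModel m).prod 𝓘(ℝ, DModel m)) ∞
      (fun z => (⟨z, modelBasis m k⟩ :
        TotalSpace (DModel m) (TangentSpace 𝓘(ℝ, DModel m) : DModel m → Type _))) (φ x) :=
    contMDiffAt_vectorSpace_iff_contDiffAt.2 contDiffAt_const
  exact (hV.mpullback_vectorField_preimage
    (contMDiffAt_of_mem_maximalAtlas (mem_smoothAtlas hφ ∞) hx)
    ⟨(mdifferentiable_chart hφ).mfderiv hx, rfl⟩ (by simp)).contMDiffWithinAt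

theorem isLocalFrameOn_coordVF (hφ : φ ∈ (doubleGroupoid m).maximalAtlas M) :
    IsLocalFrameOn 𝓘(ℝ, DModel m) (DModel m) ∞ (coordVF φ) φ.source where
  linearIndependent {x} hx := by
    rw [Fintype.linearIndependent_iff]
    intro c hc k
    rw [← dcoord_sum_smul_coordVF hφ hx c k, hc, map_zero]
  generating {x} hx v _ := by
    rw [← sum_dcoord_smul_coordVF hφ hx v]
    exact Submodule.sum_mem _ fun k _ => Submodule.smul_mem _ _ (Submodule.subset_span ⟨k, rfl⟩)
  contMDiffOn k := isSmoothVF_coordVF hφ k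

/-- The components are the fibre coordinates of the tangent map of φ composed with the smooth
section X. -/
theorem IsSmoothVF.diffAt_comp (h : IsSmoothVF U X) (hU : IsOpen U) (hxU : x ∈ U)
    (hφ : φ ∈ (doubleGroupoid m).maximalAtlas M) (hx : x ∈ φ.source) (k : Fin m ⊕ Fin m) :
    DiffAt (m := m) (comp φ k X) x := by
  have h1 := (contMDiffOn_of_mem_maximalAtlas (mem_smoothAtlas hφ ∞)).contMDiffOn_tangentMapWithin
    (m := ∞) (by simp) φ.open_source.uniqueMDiffOn
  have h2 := h1.comp (h.mono (Set.inter_subset_left (t := φ.source))) fun y hy => hy.2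
  have h3 := (contMDiff_snd_tangentBundle_modelSpace (DModel m) 𝓘(ℝ, DModel m) (n := ∞)).comp_contMDiffOn h2
  have h4 := (modelCoord k).contMDiff.comp_contMDiffOn h3
  have h5 : ContMDiffOn 𝓘(ℝ, DModel m) 𝓘(ℝ, ℝ) ∞ (comp φ k X) (U ∩ φ.source) := by
    refine h4.congr fun y hy => ?_
    rw [comp, dcoord_apply hφ hy.2, ← mfderivWithin_of_isOpen φ.open_source hy.2]
    rfl
  exact (h5.contMDiffAt ((hU.inter φ.open_source).mem_nhds ⟨hxU, hx⟩)).mdifferentiableAt (by simp)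

theorem differentiableAt_comp_symm (hφ : φ ∈ (doubleGroupoid m).maximalAtlas M) (hx : x ∈ φ.source)
    {f : M → ℝ} (hf : DiffAt (m := m) f x) :
    DifferentiableAt ℝ (f ∘ φ.symm) (φ x) := by
  have hs := (mdifferentiable_chart hφ).mdifferentiableAt_symm (φ.map_source hx)
  have hf' : DiffAt (m := m) f (φ.symm (φ x)) := by rwa [φ.left_inv hx]
  exact (hf'.comp (φ x) hs).differentiableAt

/-- The representative of a vector field in a chart. -/
def modelVF (φ : OpenPartialHomeomorph M (DModel m)) (X : ∀ x : M, TangentSpace 𝓘(ℝ, DModel m) x)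
    (z : DModel m) : DModel m :=
  ∑ k, comp φ k X (φ.symm z) • modelBasis m k

theorem modelCoord_modelVF (k : Fin m ⊕ Fin m) (z : DModel m) :
    modelCoord k (modelVF φ X z) = comp φ k X (φ.symm z) := by
  rw [modelVF, map_sum]
  simp only [map_smul, modelCoord_modelBasis, smul_eq_mul, mul_ite, mul_one, mul_zero,
    Finset.sum_ite_eq, Finset.mem_univ, if_true]

theorem modelCoord_fderiv_modelVF (hφ : φ ∈ (doubleGroupoid m).maximalAtlas M) (hx : x ∈ φ.source)
    (hX : ∀ k, DiffAt (m := m) (comp φ k X) x) (k : Fin m ⊕ Fin m) (w : DModel m) :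
    modelCoord k (fderiv ℝ (modelVF φ X) (φ x) w) =
      ∑ l, modelCoord l w * pd φ l (comp φ k X) x := by
  have hd : DifferentiableAt ℝ (modelVF φ X) (φ x) :=
    DifferentiableAt.fun_sum fun l _ => (differentiableAt_comp_symm hφ hx (hX l)).smul_const _
  have h1 : modelCoord k (fderiv ℝ (modelVF φ X) (φ x) w) =
      fderiv ℝ (comp φ k X ∘ φ.symm) (φ x) w := by
    have h := ((modelCoord k).hasFDerivAt.comp (φ x) hd.hasFDerivAt).fderiv
    have he : modelCoord k ∘ modelVF φ X = comp φ k X ∘ φ.symm :=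
      funext fun z => modelCoord_modelVF k z
    rw [he] at h
    rw [h]; rfl
  rw [h1]
  conv_lhs => rw [← sum_modelCoord_smul_modelBasis w, map_sum]
  exact Finset.sum_congr rfl fun l _ => by rw [map_smul, pd_eq_fderiv hφ hx (hX k), smul_eq_mul]

/-- `VectorField.mlieBracket` at x is defined through the preferred chart at x, where it is the
bracket of the representatives on the vector space `DModel m`; hence the formula X(Y^k) − Y(X^k) in
that chart. -/
theorem dcoord_mlieBracket (hX : ∀ k, DiffAt (m := m) (comp (chartAt (DModel m) x) k X) x)
    (hY : ∀ k, DiffAt (m := m) (comp (chartAt (DModel m) x) k Y) x) (k : Fin m ⊕ Fin m) :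
    dcoord (chartAt (DModel m) x) k x (VectorField.mlieBracket 𝓘(ℝ, DModel m) X Y x) =
      dfun (comp (chartAt (DModel m) x) k Y) x (X x) -
        dfun (comp (chartAt (DModel m) x) k X) x (Y x) := by
  have hφ := chart_mem_doubleAtlas (m := m) x
  have hx := mem_chart_source (DModel m) x
  set φ := chartAt (DModel m) x
  have hrange : Set.range 𝓘(ℝ, DModel m) = Set.univ := by simp
  let rep (Z : ∀ x : M, TangentSpace 𝓘(ℝ, DModel m) x) : DModel m → DModel m :=
    VectorField.mpullbackWithin 𝓘(ℝ, DModel m) 𝓘(ℝ, DModel m)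
        (extChartAt 𝓘(ℝ, DModel m) x).symm Z (Set.range 𝓘(ℝ, DModel m))
  -- Pulling back by φ⁻¹ is the same as applying dφ, because the two derivatives are mutually
  -- inverse.
  have hrep (Z : ∀ x : M, TangentSpace 𝓘(ℝ, DModel m) x) : rep Z =ᶠ[𝓝 (φ x)] modelVF φ Z := by
    filter_upwards [φ.open_target.mem_nhds (φ.map_source hx)] with z hz
    have hzs := φ.map_target hz
    have hm := mdifferentiable_chart hφ
    have hi : (mfderiv 𝓘(ℝ, DModel m) 𝓘(ℝ, DModel m) φ.symm z).IsInvertible :=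
      ⟨hm.symm.mfderiv hz, rfl⟩
    have h1 : rep Z z =
        (mfderiv 𝓘(ℝ, DModel m) 𝓘(ℝ, DModel m) φ.symm z).inverse (Z (φ.symm z)) := by
      change (mfderivWithin 𝓘(ℝ, DModel m) 𝓘(ℝ, DModel m) φ.symm (Set.range 𝓘(ℝ, DModel m)) z).inverse
        (Z (φ.symm z)) = _
      rw [hrange, mfderivWithin_univ]
    have h2 : (mfderiv 𝓘(ℝ, DModel m) 𝓘(ℝ, DModel m) φ.symm z).inverse (Z (φ.symm z)) =
        mfderiv 𝓘(ℝ, DModel m) 𝓘(ℝ, DModel m) φ (φ.symm z) (Z (φ.symm z)) := by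
      apply hm.symm.mfderiv_injective hz
      rw [hi.self_apply_inverse]
      have h := hm.symm_comp_deriv hzs
      rw [φ.right_inv hz] at h
      exact (DFunLike.congr_fun h (Z (φ.symm z))).symm
    refine model_ext fun k => ?_
    rw [modelCoord_modelVF, comp, dcoord_apply hφ hzs, h1]
    exact congrArg (modelCoord k) h2
  have hb : VectorField.mlieBracket 𝓘(ℝ, DModel m) X Y x =
      (mfderiv 𝓘(ℝ, DModel m) 𝓘(ℝ, DModel m) φ x).inverse
        (VectorField.lieBracket ℝ (modelVF φ X) (modelVF φ Y) (φ x) : DModel m) := by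
    have h : VectorField.lieBracketWithin ℝ (rep X) (rep Y)
        (φ.symm ⁻¹' Set.univ ∩ Set.range 𝓘(ℝ, DModel m)) (φ x) =
        VectorField.lieBracket ℝ (modelVF φ X) (modelVF φ Y) (φ x) := by
      rw [hrange, Set.preimage_univ, Set.inter_univ, VectorField.lieBracketWithin_univ]
      exact (hrep X).lieBracket_vectorField_eq (hrep Y)
    exact congrArg (mfderiv 𝓘(ℝ, DModel m) 𝓘(ℝ, DModel m) φ x).inverse h
  have hi : (mfderiv 𝓘(ℝ, DModel m) 𝓘(ℝ, DModel m) φ x).IsInvertible :=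
    ⟨(mdifferentiable_chart hφ).mfderiv hx, rfl⟩
  rw [hb, dcoord_apply hφ hx]
  refine (congrArg (modelCoord k) (hi.self_apply_inverse _)).trans ?_
  rw [VectorField.lieBracket_eq, map_sub, modelCoord_fderiv_modelVF hφ hx hY,
    modelCoord_fderiv_modelVF hφ hx hX, dfun_eq_sum hφ hx, dfun_eq_sum hφ hx]
  have h (Z : ∀ x : M, TangentSpace 𝓘(ℝ, DModel m) x) (l : Fin m ⊕ Fin m) :
      comp φ l Z (φ.symm (φ x)) = comp φ l Z x := congrArg (comp φ l Z) (φ.left_inv hx)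
  simp only [modelCoord_modelVF, h]
  rfl

end VectorFields

end

/-! ### The Courant identities as algebra of jets -/

section

variable {m : ℕ}

/-- The second order jet at a point of the components `(a, b)` of a strongly foliated vector field,
with respect to the coordinates `x^i` only. -/
structure CompJet (m : ℕ) where
  a : Fin m → ℝ
  b : Fin m → ℝ
  da : Fin m → Fin m → ℝ
  db : Fin m → Fin m → ℝ
  dda : Fin m → Fin m → Fin m → ℝ
  ddb : Fin m → Fin m → Fin m → ℝ

namespace CompJet

/-- The symmetry of second order derivatives. -/
def IsSymm (X : CompJet m) : Prop :=
  (∀ p q i, X.dda p q i = X.dda q p i) ∧ ∀ p q i, X.ddb p q i = X.ddb q p i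

/-- The first order jet of the `∇⁰`-bracket. -/
@[simps] def br (X Y : CompJet m) : CompJet m where
  a i := ∑ j, (X.a j * Y.da j i - Y.a j * X.da j i)
  b i := ∑ j, (X.a j * Y.db j i - Y.a j * X.db j i -
    1 / 2 * (X.a j * Y.db i j + X.b j * Y.da i j - Y.a j * X.db i j - Y.b j * X.da i j))
  da p i := ∑ j, ((X.da p j * Y.da j i + X.a j * Y.dda p j i) -
    (Y.da p j * X.da j i + Y.a j * X.dda p j i))
  db p i := ∑ j, ((X.da p j * Y.db j i + X.a j * Y.ddb p j i) -
    (Y.da p j * X.db j i + Y.a j * X.ddb p j i) -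
    1 / 2 * ((X.da p j * Y.db i j + X.a j * Y.ddb p i j) +
      (X.db p j * Y.da i j + X.b j * Y.dda p i j) -
      (Y.da p j * X.db i j + Y.a j * X.ddb p i j) -
      (Y.db p j * X.da i j + Y.b j * X.dda p i j)))
  -- Placeholders: the true second derivatives of a bracket would involve third derivatives of X and
  -- Y. The values of an iterated bracket and `dgamma` only read first derivatives of the inner
  -- bracket.
  dda _ _ _ := 0
  ddb _ _ _ := 0

/-- The derivatives of the scalar product of two strongly foliated vector fields. -/
def dgamma (X Y : CompJet m) (p : Fin m) : ℝ :=
  ∑ j, ((X.da p j * Y.b j + X.a j * Y.db p j) + (X.db p j * Y.a j + X.b j * Y.da p j))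

/-- Exchanging the names of the indices shows that the sum equals its own negative. -/
theorem sum_sum_eq_zero {F : Fin m → Fin m → ℝ} (h : ∀ j k, F j k + F k j = 0) :
    ∑ j, ∑ k, F j k = 0 := by
  have h1 : ∑ j, ∑ k, F j k = ∑ j, ∑ k, F k j := Finset.sum_comm
  have h2 : ∑ j, ∑ k, F j k + ∑ j, ∑ k, F k j = 0 := by
    simp only [← Finset.sum_add_distrib, h, Finset.sum_const_zero]
  linarith

/-- Writing second derivatives as S p q + S q p turns their symmetry into an identity of atoms that
`ring` can see. -/
theorem IsSymm.exists_symmetrization {X : CompJet m} (h : X.IsSymm) : ∃ S T : Fin m → Fin m → Fin m → ℝ,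
    (∀ p q i, X.dda p q i = S p q i + S q p i) ∧ ∀ p q i, X.ddb p q i = T p q i + T q p i := by
  refine ⟨fun p q i => X.dda p q i / 2, fun p q i => X.ddb p q i / 2, fun p q i => ?_,
    fun p q i => ?_⟩
  · linarith [h.1 q p i]
  · linarith [h.2 q p i]

variable {X Y Z : CompJet m}

/-- This is the Jacobi identity of the Lie bracket on the leaf space. -/
theorem jacobi_a (hX : X.IsSymm) (hY : Y.IsSymm) (hZ : Z.IsSymm) (i : Fin m) :
    ((X.br Y).br Z).a i + ((Y.br Z).br X).a i + ((Z.br X).br Y).a i = 0 := by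
  obtain ⟨X₁, -, hX, -⟩ := hX.exists_symmetrization
  obtain ⟨Y₁, -, hY, -⟩ := hY.exists_symmetrization
  obtain ⟨Z₁, -, hZ, -⟩ := hZ.exists_symmetrization
  simp only [br_a, br_da, hX, hY, hZ, Finset.sum_mul, Finset.mul_sum, ← Finset.sum_add_distrib,
    ← Finset.sum_sub_distrib]
  exact sum_sum_eq_zero fun j k => by ring

/-- The factor 1/2 on the right is that of ∂. No summand vanishes alone, but the (j, k) and (k, j)
summands of the difference cancel. -/
theorem jacobi_b (hX : X.IsSymm) (hY : Y.IsSymm) (hZ : Z.IsSymm) (i : Fin m) :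
    ((X.br Y).br Z).b i + ((Y.br Z).br X).b i + ((Z.br X).br Y).b i =
      1 / 3 * (1 / 2 * (dgamma (X.br Y) Z i + dgamma (Y.br Z) X i + dgamma (Z.br X) Y i)) := by
  obtain ⟨X₁, X₂, hX, hX'⟩ := hX.exists_symmetrization
  obtain ⟨Y₁, Y₂, hY, hY'⟩ := hY.exists_symmetrization
  obtain ⟨Z₁, Z₂, hZ, hZ'⟩ := hZ.exists_symmetrization
  rw [← sub_eq_zero]
  simp only [dgamma, br_a, br_b, br_da, br_db, hX, hY, hZ, hX', hY', hZ', Finset.sum_mul,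
    Finset.mul_sum, ← Finset.sum_add_distrib, ← Finset.sum_sub_distrib]
  exact sum_sum_eq_zero fun j k => by ring

theorem compatible (X Y Z : CompJet m) :
    ∑ i, X.a i * dgamma Y Z i =
      ∑ i, ((X.br Y).a i * Z.b i + ((X.br Y).b i + 1 / 2 * dgamma X Y i) * Z.a i) +
      ∑ i, (Y.a i * ((X.br Z).b i + 1 / 2 * dgamma X Z i) + Y.b i * (X.br Z).a i) := by
  rw [← sub_eq_zero]
  simp only [dgamma, br_a, br_b, add_mul, Finset.sum_mul,
    Finset.mul_sum, ← Finset.sum_add_distrib, ← Finset.sum_sub_distrib]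
  exact sum_sum_eq_zero fun j k => by ring

end CompJet

/-! ### Computing partial derivatives of sums and products -/

section HasPd

variable {M : Type*} [TopologicalSpace M] [ChartedSpace (DModel m) M]
  {φ : OpenPartialHomeomorph M (DModel m)} {k : Fin m ⊕ Fin m} {x : M} {f g : M → ℝ} {d e : ℝ}

/-- `f` is differentiable at `x` and its partial derivative there is `d`. -/
def HasPd (φ : OpenPartialHomeomorph M (DModel m)) (k : Fin m ⊕ Fin m) (x : M) (f : M → ℝ)
    (d : ℝ) : Prop :=
  DiffAt (m := m) f x ∧ pd φ k f x = d

theorem HasPd.add (hf : HasPd φ k x f d) (hg : HasPd φ k x g e) :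
    HasPd φ k x (fun y => f y + g y) (d + e) :=
  ⟨hf.1.add hg.1, by rw [← hf.2, ← hg.2, pd, dfun_add hf.1 hg.1]; rfl⟩

theorem HasPd.sub (hf : HasPd φ k x f d) (hg : HasPd φ k x g e) :
    HasPd φ k x (fun y => f y - g y) (d - e) :=
  ⟨hf.1.sub hg.1, by rw [← hf.2, ← hg.2, pd, dfun_sub hf.1 hg.1]; rfl⟩

/-- The derivative is written in the order used in the fields of `CompJet.br` and in
`CompJet.dgamma`, so that differentiating the coordinate formulas yields these by unfolding. -/
theorem HasPd.mul (hf : HasPd φ k x f d) (hg : HasPd φ k x g e) :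
    HasPd φ k x (fun y => f y * g y) (d * g x + f x * e) := by
  refine ⟨hf.1.mul hg.1, ?_⟩
  rw [← hf.2, ← hg.2, pd, dfun_mul hf.1 hg.1, pd, pd]
  simp only [add_apply, smul_apply, smul_eq_mul]
  ring

theorem HasPd.const_mul (c : ℝ) (hf : HasPd φ k x f d) :
    HasPd φ k x (fun y => c * f y) (c * d) :=
  ⟨mdifferentiableAt_const.mul hf.1, by rw [← hf.2, pd, dfun_const_mul c hf.1]; rfl⟩

theorem HasPd.sum {ι : Type*} {s : Finset ι} {f : ι → M → ℝ} {d : ι → ℝ}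
    (h : ∀ i ∈ s, HasPd φ k x (f i) (d i)) :
    HasPd φ k x (fun y => ∑ i ∈ s, f i y) (∑ i ∈ s, d i) := by
  refine ⟨diffAt_sum fun i hi => (h i hi).1, ?_⟩
  rw [pd, dfun_sum fun i hi => (h i hi).1, sum_apply]
  exact Finset.sum_congr rfl fun i hi => (h i hi).2

theorem HasPd.congr (hf : HasPd φ k x f d) (h : g =ᶠ[𝓝 x] f) : HasPd φ k x g d :=
  ⟨hf.1.congr_of_eventuallyEq h, by rw [← hf.2, pd, dfun_congr h]; rfl⟩

end HasPd

/-! ### Jets of strongly foliated fields and closure under the bracket -/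

section JetOfSection

variable {M : Type*} [TopologicalSpace M] [ChartedSpace (DModel m) M]
  [HasGroupoid M (doubleGroupoid m)] {φ : OpenPartialHomeomorph M (DModel m)}
  {U : Set M} {s t : ∀ x : M, TangentSpace 𝓘(ℝ, DModel m) x} {x : M}

/-- The jet of the components of a vector field. -/
@[simps] def jet (φ : OpenPartialHomeomorph M (DModel m))
    (s : ∀ x : M, TangentSpace 𝓘(ℝ, DModel m) x) (x : M) : CompJet m where
  a i := comp φ (Sum.inl i) s x
  b i := comp φ (Sum.inr i) s x
  da p i := pd φ (Sum.inl p) (comp φ (Sum.inl i) s) x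
  db p i := pd φ (Sum.inl p) (comp φ (Sum.inr i) s) x
  dda p q i := pd φ (Sum.inl p) (pd φ (Sum.inl q) (comp φ (Sum.inl i) s)) x
  ddb p q i := pd φ (Sum.inl p) (pd φ (Sum.inl q) (comp φ (Sum.inr i) s)) x

theorem IsFoliatedSec.hasPd (hs : IsStrFoliated U s) (hU : IsOpen U)
    (hφ : φ ∈ (doubleGroupoid m).maximalAtlas M) (hxU : x ∈ U) (hx : x ∈ φ.source)
    (k l : Fin m ⊕ Fin m) : HasPd φ k x (DoubleField.comp φ l s) (pd φ k (DoubleField.comp φ l s) x) :=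
  ⟨hs.diffAt_comp hU hxU hφ hx l, rfl⟩

theorem IsFoliatedSec.hasPd_pd (hs : IsStrFoliated U s) (hU : IsOpen U)
    (hφ : φ ∈ (doubleGroupoid m).maximalAtlas M) (hxU : x ∈ U) (hx : x ∈ φ.source)
    (k l : Fin m ⊕ Fin m) (p : Fin m) :
    HasPd φ k x (pd φ (Sum.inl p) (DoubleField.comp φ l s)) (pd φ k (pd φ (Sum.inl p) (DoubleField.comp φ l s)) x) :=
  ⟨((hs.comp hU hφ l).pd (hU.inter φ.open_source) Set.inter_subset_right hφ p).diffAt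
    (hU.inter φ.open_source) ⟨hxU, hx⟩, rfl⟩

theorem IsFoliatedSec.jet_isSymm (hs : IsStrFoliated U s) (hU : IsOpen U)
    (hφ : φ ∈ (doubleGroupoid m).maximalAtlas M) (hxU : x ∈ U) (hx : x ∈ φ.source) :
    (jet φ s x).IsSymm :=
  ⟨fun _ _ i => pd_comm (hU.inter φ.open_source) (hs.comp hU hφ (Sum.inl i)).1
    Set.inter_subset_right hφ _ _ ⟨hxU, hx⟩,
  fun _ _ i => pd_comm (hU.inter φ.open_source) (hs.comp hU hφ (Sum.inr i)).1
    Set.inter_subset_right hφ _ _ ⟨hxU, hx⟩⟩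

/-- The coordinate formula for the bracket holds throughout a neighbourhood of x, so it can be
differentiated term by term. -/
theorem hasPd_comp_bracket0_inl (hs : IsStrFoliated U s) (ht : IsStrFoliated U t) (hU : IsOpen U)
    (hφ : φ ∈ (doubleGroupoid m).maximalAtlas M) (hxU : x ∈ U) (hx : x ∈ φ.source) (p i : Fin m) :
    HasPd φ (Sum.inl p) x (comp φ (Sum.inl i) (bracket0 s t))
      (((jet φ s x).br (jet φ t x)).da p i) := by
  have h := HasPd.sum (s := Finset.univ) fun (j : Fin m) _ =>
    ((hs.hasPd hU hφ hxU hx (.inl p) (.inl j)).mul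
      (ht.hasPd_pd hU hφ hxU hx (.inl p) (.inl i) j)).sub
    ((ht.hasPd hU hφ hxU hx (.inl p) (.inl j)).mul
      (hs.hasPd_pd hU hφ hxU hx (.inl p) (.inl i) j))
  exact h.congr (Filter.eventuallyEq_of_mem ((hU.inter φ.open_source).mem_nhds ⟨hxU, hx⟩)
    fun y hy => comp_bracket0_inl hs ht hU hφ hy.1 hy.2 i)

theorem hasPd_comp_bracket0_inr (hs : IsStrFoliated U s) (ht : IsStrFoliated U t) (hU : IsOpen U)
    (hφ : φ ∈ (doubleGroupoid m).maximalAtlas M) (hxU : x ∈ U) (hx : x ∈ φ.source) (p i : Fin m) :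
    HasPd φ (Sum.inl p) x (comp φ (Sum.inr i) (bracket0 s t))
      (((jet φ s x).br (jet φ t x)).db p i) := by
  have h0 {r : ∀ x : M, TangentSpace 𝓘(ℝ, DModel m) x} (hr : IsStrFoliated U r) :=
    hr.hasPd hU hφ hxU hx (.inl p)
  have h1 {r : ∀ x : M, TangentSpace 𝓘(ℝ, DModel m) x} (hr : IsStrFoliated U r) :=
    hr.hasPd_pd hU hφ hxU hx (.inl p)
  have h := HasPd.sum (s := Finset.univ) fun (j : Fin m) _ =>
    (((h0 hs (.inl j)).mul (h1 ht (.inr i) j)).sub ((h0 ht (.inl j)).mul (h1 hs (.inr i) j))).sub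
    ((((((h0 hs (.inl j)).mul (h1 ht (.inr j) i)).add ((h0 hs (.inr j)).mul (h1 ht (.inl j) i))).sub
      ((h0 ht (.inl j)).mul (h1 hs (.inr j) i))).sub
      ((h0 ht (.inr j)).mul (h1 hs (.inl j) i))).const_mul (1 / 2))
  exact h.congr (Filter.eventuallyEq_of_mem ((hU.inter φ.open_source).mem_nhds ⟨hxU, hx⟩)
    fun y hy => comp_bracket0_inr hs ht hU hφ hy.1 hy.2 i)

theorem hasPd_gammaMetric (hs : IsStrFoliated U s) (ht : IsStrFoliated U t) (hU : IsOpen U)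
    (hφ : φ ∈ (doubleGroupoid m).maximalAtlas M) (hxU : x ∈ U) (hx : x ∈ φ.source) (p : Fin m) :
    HasPd φ (Sum.inl p) x (fun y => gammaMetric m M y (s y) (t y))
      (CompJet.dgamma (jet φ s x) (jet φ t x) p) := by
  have h0 {r : ∀ x : M, TangentSpace 𝓘(ℝ, DModel m) x} (hr : IsStrFoliated U r) :=
    hr.hasPd hU hφ hxU hx (.inl p)
  have h := HasPd.sum (s := Finset.univ) fun (j : Fin m) _ =>
    ((h0 hs (.inl j)).mul (h0 ht (.inr j))).add ((h0 hs (.inr j)).mul (h0 ht (.inl j)))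
  exact h.congr (Filter.eventuallyEq_of_mem (φ.open_source.mem_nhds hx)
    fun y hy => gammaMetric_apply hφ hy _ _)

theorem isFoliatedFun_gammaMetric (hs : IsStrFoliated U s) (ht : IsStrFoliated U t)
    (hU : IsOpen U) :
    IsFoliatedFun (foliationLt m M) U (fun y => gammaMetric m M y (s y) (t y)) := by
  refine isFoliatedFun_of_forall fun x hx => ⟨(chartAt (DModel m) x).source,
    (chartAt _ x).open_source, mem_chart_source _ x, ?_⟩
  have hφ := chart_mem_doubleAtlas (m := m) x
  have hW := hU.inter (chartAt (DModel m) x).open_source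
  refine IsFoliatedFun.congr (f := fun y => ∑ i, (comp (chartAt (DModel m) x) (.inl i) s y *
    comp (chartAt (DModel m) x) (.inr i) t y + comp (chartAt (DModel m) x) (.inr i) s y *
    comp (chartAt (DModel m) x) (.inl i) t y)) ?_ hW fun y hy => gammaMetric_apply hφ hy.2 _ _
  exact IsFoliatedFun.sum (fun i _ => ((hs.comp hU hφ _).mul (ht.comp hU hφ _) hW).add
    ((hs.comp hU hφ _).mul (ht.comp hU hφ _) hW) hW) hW

theorem isStrFoliated_bracket0 (hs : IsStrFoliated U s) (ht : IsStrFoliated U t)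
    (hU : IsOpen U) : IsStrFoliated U (bracket0 s t) := by
  refine isStrFoliated_of_comp fun φ hφ k => ?_
  have hW := hU.inter φ.open_source
  have h0 {r : ∀ x : M, TangentSpace 𝓘(ℝ, DModel m) x} (hr : IsStrFoliated U r) :=
    hr.comp hU hφ
  have h1 {r : ∀ x : M, TangentSpace 𝓘(ℝ, DModel m) x} (hr : IsStrFoliated U r)
    (k : Fin m ⊕ Fin m) := (hr.comp hU hφ k).pd hW Set.inter_subset_right hφ
  rcases k with i | i
  · refine (IsFoliatedFun.sum (s := Finset.univ) (fun (j : Fin m) _ =>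
      ((h0 hs (.inl j)).mul (h1 ht (.inl i) j) hW).sub
        ((h0 ht (.inl j)).mul (h1 hs (.inl i) j) hW) hW) hW).congr hW
      fun y hy => comp_bracket0_inl hs ht hU hφ hy.1 hy.2 i
  · refine (IsFoliatedFun.sum (s := Finset.univ) (fun (j : Fin m) _ =>
      (((h0 hs (.inl j)).mul (h1 ht (.inr i) j) hW).sub
        ((h0 ht (.inl j)).mul (h1 hs (.inr i) j) hW) hW).sub
      ((isFoliatedFun_const (1 / 2)).mul
        (((((h0 hs (.inl j)).mul (h1 ht (.inr j) i) hW).add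
          ((h0 hs (.inr j)).mul (h1 ht (.inl j) i) hW) hW).sub
        ((h0 ht (.inl j)).mul (h1 hs (.inr j) i) hW) hW).sub
        ((h0 ht (.inr j)).mul (h1 hs (.inl j) i) hW) hW) hW) hW) hW).congr hW
      fun y hy => comp_bracket0_inr hs ht hU hφ hy.1 hy.2 i

end JetOfSection

end

/-! ### Verification of the axioms -/

section

variable {m : ℕ} {M : Type*} [TopologicalSpace M] [ChartedSpace (DModel m) M]
  [HasGroupoid M (doubleGroupoid m)] {φ ψ : OpenPartialHomeomorph M (DModel m)}

section Axioms

variable {U : Set M} {s t r : ∀ x : M, TangentSpace 𝓘(ℝ, DModel m) x} {f : M → ℝ} {x : M}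

theorem isFoliation_foliationLt : IsFoliation (foliationLt m M) := by
  -- In every distinguished chart the leaves are the slices parallel to the second factor.
  refine ⟨LinearMap.ker (LinearMap.fst ℝ (Fin m → ℝ) (Fin m → ℝ)), fun x =>
    ⟨chartAt _ x, mem_smoothAtlas (chart_mem_doubleAtlas x) ∞, mem_chart_source _ x,
      fun y hy v => ?_⟩⟩
  rw [mem_foliationLt_iff (chart_mem_doubleAtlas x) hy]
  simp only [dcoord_apply (chart_mem_doubleAtlas x) hy]
  exact funext_iff.symm

theorem isFoliatedBundle_distinguishedFrames :
    IsFoliatedBundle (V := DModel m) (foliationLt m M) (distinguishedFrames m M) where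
  isOpen := by
    rintro _ ⟨φ, hφ, rfl⟩
    exact φ.open_source
  frame := by
    rintro _ ⟨φ, hφ, rfl⟩
    exact isLocalFrameOn_coordVF hφ
  cover x := ⟨_, ⟨_, chart_mem_doubleAtlas x, rfl⟩, mem_chart_source _ x⟩
  transition := by
    rintro _ ⟨ψ, hψ, rfl⟩ k
    refine isStrFoliated_of_comp fun φ hφ l => isFoliatedFun_of_forall fun x hx => ?_
    obtain ⟨α, β, -, hz⟩ := dcoord_transition hφ hψ hx.2 hx.1
    obtain ⟨V, hV, hVo, hxV⟩ := eventually_nhds_iff.1 hz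
    -- The components of one frame in another are entries of α or β, or 0; near x they keep their
    -- value at x.
    refine ⟨V, hVo, hxV, (isFoliatedFun_const (comp φ l (coordVF ψ k) x)).congr
      ((ψ.open_source.inter φ.open_source).inter hVo) fun y hy => ?_⟩
    have hy0 := hV y hy.2 (coordVF ψ k y)
    have hx0 := hV x hxV (coordVF ψ k x)
    rcases l with i | i
    · rw [comp, comp, hy0.1, hx0.1]
      simp only [dcoord_coordVF hψ hy.1.1, dcoord_coordVF hψ hx.1]
    · rw [comp, comp, hy0.2, hx0.2]
      simp only [dcoord_coordVF hψ hy.1.1, dcoord_coordVF hψ hx.1]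

theorem IsFoliatedSec.isSmoothVF (hs : IsStrFoliated U s) (hU : IsOpen U) : IsSmoothVF U s := by
  intro x hx
  have hφ := chart_mem_doubleAtlas (m := m) x
  have hxφ := mem_chart_source (DModel m) x
  have hW := (hU.inter (chartAt (DModel m) x).open_source).mem_nhds ⟨hx, hxφ⟩
  have h : ContMDiffAt 𝓘(ℝ, DModel m) (𝓘(ℝ, DModel m).prod 𝓘(ℝ, DModel m)) ∞
      (fun y => (⟨y, ∑ k, DoubleField.comp (chartAt (DModel m) x) k s y •
        coordVF (chartAt (DModel m) x) k y⟩ :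
        TotalSpace (DModel m) (TangentSpace 𝓘(ℝ, DModel m) : M → Type _))) x :=
    .sum_section fun k _ => ((hs.comp hU hφ k).1.contMDiffAt hW).smul_section
      ((isSmoothVF_coordVF hφ k).contMDiffAt
        ((chartAt (DModel m) x).open_source.mem_nhds hxφ))
  refine (h.congr_of_eventuallyEq ?_).contMDiffWithinAt
  filter_upwards [(chartAt (DModel m) x).open_source.mem_nhds hxφ] with y hy
  exact congrArg (TotalSpace.mk y) (sum_dcoord_smul_coordVF hφ hy (s y)).symm

/-- The x^i-component of [s, Z] is s(Z^i) − Z(s^i): Z^i vanishes identically near x, and s^i is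
foliated. -/
theorem IsFoliatedSec.isFoliatedVF (hs : IsStrFoliated U s) (hU : IsOpen U) :
    IsFoliatedVF (foliationLt m M) U s := by
  refine ⟨hs.isSmoothVF hU, fun V hVU hV Z hZ hZL x hx => ?_⟩
  have hφ := chart_mem_doubleAtlas (m := m) x
  have hxφ := mem_chart_source (DModel m) x
  rw [mem_foliationLt_iff hφ hxφ]
  intro i
  rw [dcoord_mlieBracket (hs.diffAt_comp hU (hVU hx) hφ hxφ) (hZ.diffAt_comp hV hx hφ hxφ)]
  have h0 : DoubleField.comp (chartAt (DModel m) x) (Sum.inl i) Z =ᶠ[𝓝 x] fun _ => 0 :=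
    Filter.eventuallyEq_of_mem
      ((hV.inter (chartAt (DModel m) x).open_source).mem_nhds ⟨hx, hxφ⟩)
      fun y hy => (mem_foliationLt_iff hφ hy.2).1 (hZL y hy.1) i
  rw [dfun_congr h0, dfun_const,
    (isFoliatedFun_iff.1 (hs.comp hU hφ (Sum.inl i))).2 x ⟨hVU hx, hxφ⟩ _ (hZL x hx)]
  simp

theorem isStrFoliated_transPartial (hf : IsFoliatedFun (foliationLt m M) U f) (hU : IsOpen U) :
    IsStrFoliated U (transPartial (foliationLt m M) (gammaMetric m M) (anchorL m M) f) := by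
  refine isStrFoliated_of_comp fun φ hφ k => ?_
  have hW := hU.inter φ.open_source
  rcases k with i | i
  · exact (isFoliatedFun_const 0).congr hW fun y hy => dcoord_inl_transPartial hf hy.1 hφ hy.2 i
  · exact ((isFoliatedFun_const (1 / 2)).mul ((hf.mono Set.inter_subset_left).pd hW
      Set.inter_subset_right hφ i) hW).congr hW
      fun y hy => dcoord_inr_transPartial hf hy.1 hφ hy.2 i

theorem IsFoliatedSec.add (hs : IsStrFoliated U s) (ht : IsStrFoliated U t) (hU : IsOpen U) :
    IsStrFoliated U (s + t) := by
  refine isStrFoliated_of_comp fun φ hφ k => ?_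
  have hW := hU.inter φ.open_source
  exact ((hs.comp hU hφ k).add (ht.comp hU hφ k) hW).congr hW fun y _ => map_add (dcoord φ k y) _ _

theorem IsFoliatedSec.fun_smul (hf : IsFoliatedFun (foliationLt m M) U f) (hs : IsStrFoliated U s)
    (hU : IsOpen U) : IsStrFoliated U (fun y => f y • s y) := by
  refine isStrFoliated_of_comp fun φ hφ k => ?_
  have hW := hU.inter φ.open_source
  exact ((hf.mono Set.inter_subset_left).mul (hs.comp hU hφ k) hW).congr hW
    fun y _ => map_smul (dcoord φ k y) _ _

theorem bracket0_add (hs : IsStrFoliated U s) (ht : IsStrFoliated U t) (hr : IsStrFoliated U r)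
    (hU : IsOpen U) (hx : x ∈ U) :
    bracket0 (s + t) r x = bracket0 s r x + bracket0 t r x := by
  have hφ := chart_mem_doubleAtlas (m := m) x
  have hxφ := mem_chart_source (DModel m) x
  have hst := hs.add ht hU
  have hc (k) : comp (chartAt (DModel m) x) k (s + t) x =
      comp (chartAt (DModel m) x) k s x + comp (chartAt (DModel m) x) k t x :=
    map_add (dcoord _ k x) _ _
  have hp (k l) : pd (chartAt (DModel m) x) l (comp (chartAt (DModel m) x) k (s + t)) x =
      pd (chartAt (DModel m) x) l (comp (chartAt (DModel m) x) k s) x +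
      pd (chartAt (DModel m) x) l (comp (chartAt (DModel m) x) k t) x :=
    (((hs.hasPd hU hφ hx hxφ l k).add (ht.hasPd hU hφ hx hxφ l k)).congr
      (.of_forall fun y => map_add (dcoord _ k y) _ _)).2
  refine tangent_ext hφ hxφ fun k => ?_
  rw [map_add]
  change comp _ k _ x = comp _ k _ x + comp _ k _ x
  rcases k with i | i
  · simp only [comp_bracket0_inl hst hr hU hφ hx hxφ, comp_bracket0_inl hs hr hU hφ hx hxφ,
      comp_bracket0_inl ht hr hU hφ hx hxφ, hc, hp, ← Finset.sum_add_distrib]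
    exact Finset.sum_congr rfl fun j _ => by ring
  · simp only [comp_bracket0_inr hst hr hU hφ hx hxφ, comp_bracket0_inr hs hr hU hφ hx hxφ,
      comp_bracket0_inr ht hr hU hφ hx hxφ, hc, hp, ← Finset.sum_add_distrib]
    exact Finset.sum_congr rfl fun j _ => by ring

theorem bracket0_skew (hs : IsStrFoliated U s) (ht : IsStrFoliated U t)
    (hU : IsOpen U) (hx : x ∈ U) : bracket0 s t x = - bracket0 t s x := by
  have hφ := chart_mem_doubleAtlas (m := m) x
  have hxφ := mem_chart_source (DModel m) x
  refine tangent_ext hφ hxφ fun k => ?_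
  rw [map_neg]
  change comp _ k _ x = - comp _ k _ x
  rcases k with i | i
  · simp only [comp_bracket0_inl hs ht hU hφ hx hxφ, comp_bracket0_inl ht hs hU hφ hx hxφ,
      ← Finset.sum_neg_distrib]
    exact Finset.sum_congr rfl fun j _ => by ring
  · simp only [comp_bracket0_inr hs ht hU hφ hx hxφ, comp_bracket0_inr ht hs hU hφ hx hxφ,
      ← Finset.sum_neg_distrib]
    exact Finset.sum_congr rfl fun j _ => by ring

/-- Differentiating f in the transport terms gives (ρ(s) f) t; differentiating it in the terms with
factor 1/2 gives ½ γ(s, t) ∂_i f, the component of γ(s, t) ∂f. -/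
theorem bracket0_fun_smul (hs : IsStrFoliated U s) (ht : IsStrFoliated U t)
    (hf : IsFoliatedFun (foliationLt m M) U f) (hU : IsOpen U) (hx : x ∈ U) :
    bracket0 s (fun y => f y • t y) x = f x • bracket0 s t x +
      transDiff (foliationLt m M) f x (anchorL m M x (s x)) • t x -
      gammaMetric m M x (s x) (t x) •
        transPartial (foliationLt m M) (gammaMetric m M) (anchorL m M) f x := by
  have hφ := chart_mem_doubleAtlas (m := m) x
  have hxφ := mem_chart_source (DModel m) x
  have hft := IsFoliatedSec.fun_smul hf ht hU
  have hc (k) : comp (chartAt (DModel m) x) k (fun y => f y • t y) x =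
      f x * comp (chartAt (DModel m) x) k t x := map_smul (dcoord _ k x) _ _
  have hp (k l) : pd (chartAt (DModel m) x) l (comp (chartAt (DModel m) x) k (fun y => f y • t y)) x =
      pd (chartAt (DModel m) x) l f x * comp (chartAt (DModel m) x) k t x +
      f x * pd (chartAt (DModel m) x) l (comp (chartAt (DModel m) x) k t) x :=
    ((HasPd.mul ⟨hf.diffAt hU hx, rfl⟩ (ht.hasPd hU hφ hx hxφ l k)).congr
      (.of_forall fun y => map_smul (dcoord _ k y) _ _)).2
  rw [transDiff_anchorL hf hx, (hf.mono (Set.inter_subset_left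
    (t := (chartAt (DModel m) x).source))).dfun_eq hφ ⟨hx, hxφ⟩ hxφ]
  refine tangent_ext hφ hxφ fun k => ?_
  rw [map_sub, map_add, map_smul, map_smul, map_smul]
  change comp _ k _ x = f x * comp _ k _ x + _ * comp _ k t x - _ * _
  rcases k with i | i
  · rw [dcoord_inl_transPartial hf hx hφ hxφ]
    simp only [comp_bracket0_inl hs hft hU hφ hx hxφ, comp_bracket0_inl hs ht hU hφ hx hxφ,
      hc, hp, Finset.mul_sum, Finset.sum_mul, ← Finset.sum_add_distrib, mul_zero, sub_zero]
    refine Finset.sum_congr rfl fun j _ => ?_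
    simp only [comp]
    ring
  · rw [dcoord_inr_transPartial hf hx hφ hxφ, gammaMetric_apply hφ hxφ]
    simp only [comp_bracket0_inr hs hft hU hφ hx hxφ, comp_bracket0_inr hs ht hU hφ hx hxφ,
      hc, hp, Finset.mul_sum, Finset.sum_mul, ← Finset.sum_add_distrib, ← Finset.sum_sub_distrib]
    refine Finset.sum_congr rfl fun j _ => ?_
    simp only [comp]
    ring

/-- Links the geometric iterated bracket to the jet algebra: the jet of `bracket0 s t` agrees with
`CompJet.br` up to first order, and no more is read. -/
theorem comp_bracket0_bracket0_inl (hs : IsStrFoliated U s) (ht : IsStrFoliated U t)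
    (hr : IsStrFoliated U r) (hU : IsOpen U) (hφ : φ ∈ (doubleGroupoid m).maximalAtlas M)
    (hxU : x ∈ U) (hx : x ∈ φ.source) (i : Fin m) :
    comp φ (Sum.inl i) (bracket0 (bracket0 s t) r) x =
      (((jet φ s x).br (jet φ t x)).br (jet φ r x)).a i := by
  rw [comp_bracket0_inl (isStrFoliated_bracket0 hs ht hU) hr hU hφ hxU hx]
  simp only [(hasPd_comp_bracket0_inl hs ht hU hφ hxU hx _ _).2,
    comp_bracket0_inl hs ht hU hφ hxU hx]
  rfl

theorem comp_bracket0_bracket0_inr (hs : IsStrFoliated U s) (ht : IsStrFoliated U t)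
    (hr : IsStrFoliated U r) (hU : IsOpen U) (hφ : φ ∈ (doubleGroupoid m).maximalAtlas M)
    (hxU : x ∈ U) (hx : x ∈ φ.source) (i : Fin m) :
    comp φ (Sum.inr i) (bracket0 (bracket0 s t) r) x =
      (((jet φ s x).br (jet φ t x)).br (jet φ r x)).b i := by
  rw [comp_bracket0_inr (isStrFoliated_bracket0 hs ht hU) hr hU hφ hxU hx]
  simp only [(hasPd_comp_bracket0_inl hs ht hU hφ hxU hx _ _).2,
    (hasPd_comp_bracket0_inr hs ht hU hφ hxU hx _ _).2,
    comp_bracket0_inl hs ht hU hφ hxU hx, comp_bracket0_inr hs ht hU hφ hxU hx]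
  rfl

theorem hasPd_gammaMetric_bracket0 (hs : IsStrFoliated U s) (ht : IsStrFoliated U t)
    (hr : IsStrFoliated U r) (hU : IsOpen U) (hφ : φ ∈ (doubleGroupoid m).maximalAtlas M)
    (hxU : x ∈ U) (hx : x ∈ φ.source) (p : Fin m) :
    HasPd φ (Sum.inl p) x (fun y => gammaMetric m M y (bracket0 s t y) (r y))
      (CompJet.dgamma ((jet φ s x).br (jet φ t x)) (jet φ r x) p) := by
  have h := hasPd_gammaMetric (isStrFoliated_bracket0 hs ht hU) hr hU hφ hxU hx p
  refine ⟨h.1, h.2.trans ?_⟩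
  simp only [CompJet.dgamma, jet_a, jet_b, jet_da, jet_db,
    (hasPd_comp_bracket0_inl hs ht hU hφ hxU hx _ _).2,
    (hasPd_comp_bracket0_inr hs ht hU hφ hxU hx _ _).2,
    comp_bracket0_inl hs ht hU hφ hxU hx, comp_bracket0_inr hs ht hU hφ hxU hx]
  rfl

theorem bracket0_jacobi (hs : IsStrFoliated U s) (ht : IsStrFoliated U t)
    (hr : IsStrFoliated U r) (hU : IsOpen U) (hx : x ∈ U) :
    bracket0 (bracket0 s t) r x + bracket0 (bracket0 t r) s x + bracket0 (bracket0 r s) t x =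
      (1 / 3 : ℝ) • transPartial (foliationLt m M) (gammaMetric m M) (anchorL m M)
        (fun y => gammaMetric m M y (bracket0 s t y) (r y) +
          gammaMetric m M y (bracket0 t r y) (s y) + gammaMetric m M y (bracket0 r s y) (t y)) x := by
  have hφ := chart_mem_doubleAtlas (m := m) x
  have hxφ := mem_chart_source (DModel m) x
  have hf := ((isFoliatedFun_gammaMetric (isStrFoliated_bracket0 hs ht hU) hr hU).add
    (isFoliatedFun_gammaMetric (isStrFoliated_bracket0 ht hr hU) hs hU) hU).add
    (isFoliatedFun_gammaMetric (isStrFoliated_bracket0 hr hs hU) ht hU) hU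
  have js := hs.jet_isSymm hU hφ hx hxφ
  have jt := ht.jet_isSymm hU hφ hx hxφ
  have jr := hr.jet_isSymm hU hφ hx hxφ
  refine tangent_ext hφ hxφ fun k => ?_
  rw [map_add, map_add, map_smul]
  change comp _ k _ x + comp _ k _ x + comp _ k _ x = 1 / 3 * _
  rcases k with i | i
  · rw [dcoord_inl_transPartial hf hx hφ hxφ, comp_bracket0_bracket0_inl hs ht hr hU hφ hx hxφ,
      comp_bracket0_bracket0_inl ht hr hs hU hφ hx hxφ,
      comp_bracket0_bracket0_inl hr hs ht hU hφ hx hxφ, CompJet.jacobi_a js jt jr, mul_zero]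
  · rw [dcoord_inr_transPartial hf hx hφ hxφ, comp_bracket0_bracket0_inr hs ht hr hU hφ hx hxφ,
      comp_bracket0_bracket0_inr ht hr hs hU hφ hx hxφ,
      comp_bracket0_bracket0_inr hr hs ht hU hφ hx hxφ, CompJet.jacobi_b js jt jr,
      (((hasPd_gammaMetric_bracket0 hs ht hr hU hφ hx hxφ i).add
        (hasPd_gammaMetric_bracket0 ht hr hs hU hφ hx hxφ i)).add
        (hasPd_gammaMetric_bracket0 hr hs ht hU hφ hx hxφ i)).2]

/-- X and s have the same x^i-components on U, and these are foliated, so their derivatives along Y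
involve only the x^j-components of Y, which are those of t. The Lie bracket formula then becomes
`comp_bracket0_inl`. -/
theorem anchorL_bracket0 (hs : IsStrFoliated U s) (ht : IsStrFoliated U t) (hU : IsOpen U)
    {X Y : ∀ x : M, TangentSpace 𝓘(ℝ, DModel m) x} (hX : IsSmoothVF U X) (hY : IsSmoothVF U Y)
    (hsX : ∀ x ∈ U, anchorL m M x (s x) = (foliationLt m M x).mkQ (X x))
    (htY : ∀ x ∈ U, anchorL m M x (t x) = (foliationLt m M x).mkQ (Y x)) (hx : x ∈ U) :
    anchorL m M x (bracket0 s t x) =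
      (foliationLt m M x).mkQ (VectorField.mlieBracket 𝓘(ℝ, DModel m) X Y x) := by
  have hφ := chart_mem_doubleAtlas (m := m) x
  have hxφ := mem_chart_source (DModel m) x
  have hW := hU.inter (chartAt (DModel m) x).open_source
  have hc {s X : ∀ x : M, TangentSpace 𝓘(ℝ, DModel m) x}
      (h : ∀ x ∈ U, anchorL m M x (s x) = (foliationLt m M x).mkQ (X x)) (i : Fin m) :
      ∀ y ∈ U ∩ (chartAt (DModel m) x).source,
        comp (chartAt (DModel m) x) (Sum.inl i) X y =
          comp (chartAt (DModel m) x) (Sum.inl i) s y := by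
    intro y hy
    have h1 := h y hy.1
    rw [anchorL_apply, Submodule.mkQ_apply, Submodule.mkQ_apply, Submodule.Quotient.eq,
      mem_foliationLt_iff hφ hy.2] at h1
    have h2 := h1 i
    rw [map_sub, sub_eq_zero] at h2
    exact h2.symm
  rw [anchorL_apply, Submodule.mkQ_apply, Submodule.mkQ_apply, Submodule.Quotient.eq,
    mem_foliationLt_iff hφ hxφ]
  intro i
  rw [map_sub, dcoord_mlieBracket (hX.diffAt_comp hU hx hφ hxφ) (hY.diffAt_comp hU hx hφ hxφ),
    dfun_congr (Filter.eventuallyEq_of_mem (hW.mem_nhds ⟨hx, hxφ⟩) (hc hsX i)),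
    dfun_congr (Filter.eventuallyEq_of_mem (hW.mem_nhds ⟨hx, hxφ⟩) (hc htY i)),
    (hs.comp hU hφ (Sum.inl i)).dfun_eq hφ ⟨hx, hxφ⟩ hxφ,
    (ht.comp hU hφ (Sum.inl i)).dfun_eq hφ ⟨hx, hxφ⟩ hxφ, sub_eq_zero, ← Finset.sum_sub_distrib]
  refine (comp_bracket0_inl hs ht hU hφ hx hxφ i).trans (Finset.sum_congr rfl fun j _ => ?_)
  rw [← hc hsX j x ⟨hx, hxφ⟩, ← hc htY j x ⟨hx, hxφ⟩]
  rfl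

theorem anchorL_transPartial (hf : IsFoliatedFun (foliationLt m M) U f) (hx : x ∈ U) :
    anchorL m M x (transPartial (foliationLt m M) (gammaMetric m M) (anchorL m M) f x) = 0 := by
  rw [anchorL_apply, Submodule.mkQ_apply, Submodule.Quotient.mk_eq_zero,
    mem_foliationLt_iff (chart_mem_doubleAtlas x) (mem_chart_source _ x)]
  exact dcoord_inl_transPartial hf hx (chart_mem_doubleAtlas x) (mem_chart_source _ x)

theorem bracket0_compatible (hs : IsStrFoliated U s) (ht : IsStrFoliated U t)
    (hr : IsStrFoliated U r) (hU : IsOpen U) (hx : x ∈ U) :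
    transDiff (foliationLt m M) (fun y => gammaMetric m M y (t y) (r y)) x
        (anchorL m M x (s x)) =
      gammaMetric m M x (bracket0 s t x + transPartial (foliationLt m M) (gammaMetric m M)
        (anchorL m M) (fun y => gammaMetric m M y (s y) (t y)) x) (r x) +
      gammaMetric m M x (t x) (bracket0 s r x + transPartial (foliationLt m M) (gammaMetric m M)
        (anchorL m M) (fun y => gammaMetric m M y (s y) (r y)) x) := by
  have hφ := chart_mem_doubleAtlas (m := m) x
  have hxφ := mem_chart_source (DModel m) x
  have hst := isFoliatedFun_gammaMetric hs ht hU
  have hsr := isFoliatedFun_gammaMetric hs hr hU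
  have htr := isFoliatedFun_gammaMetric ht hr hU
  have ca {s t : ∀ x : M, TangentSpace 𝓘(ℝ, DModel m) x} (hs : IsStrFoliated U s)
      (ht : IsStrFoliated U t) (i) :
      dcoord (chartAt (DModel m) x) (Sum.inl i) x (bracket0 s t x) = _ :=
    comp_bracket0_inl hs ht hU hφ hx hxφ i
  have cb {s t : ∀ x : M, TangentSpace 𝓘(ℝ, DModel m) x} (hs : IsStrFoliated U s)
      (ht : IsStrFoliated U t) (i) :
      dcoord (chartAt (DModel m) x) (Sum.inr i) x (bracket0 s t x) = _ :=
    comp_bracket0_inr hs ht hU hφ hx hxφ i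
  rw [transDiff_anchorL htr hx, htr.dfun_eq hφ hx hxφ, gammaMetric_apply hφ hxφ,
    gammaMetric_apply hφ hxφ]
  simp only [map_add, dcoord_inl_transPartial hst hx hφ hxφ, dcoord_inr_transPartial hst hx hφ hxφ,
    dcoord_inl_transPartial hsr hx hφ hxφ, dcoord_inr_transPartial hsr hx hφ hxφ,
    (hasPd_gammaMetric hs ht hU hφ hx hxφ _).2, (hasPd_gammaMetric hs hr hU hφ hx hxφ _).2,
    (hasPd_gammaMetric ht hr hU hφ hx hxφ _).2, add_zero, ca hs ht, cb hs ht, ca hs hr, cb hs hr]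
  exact CompJet.compatible (jet (chartAt (DModel m) x) s x) (jet (chartAt (DModel m) x) t x)
    (jet (chartAt (DModel m) x) r x)

end Axioms

end

end DoubleField

end

/-! ### Assembly of the transversal Courant algebroid -/

theorem corollary3p2 (m : ℕ) {M : Type*} [TopologicalSpace M] [ChartedSpace (DoubleField.DModel m) M]
    [HasGroupoid M (DoubleField.doubleGroupoid m)] :
    DoubleField.IsTransversalCourantAlgebroid (V := DoubleField.DModel m)
      (DoubleField.foliationLt m M) (DoubleField.distinguishedFrames m M)
      (DoubleField.gammaMetric m M) (DoubleField.anchorL m M) DoubleField.bracket0 where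
  foliation := DoubleField.isFoliation_foliationLt
  bundle := DoubleField.isFoliatedBundle_distinguishedFrames
  metric_symm _ _ _ := DoubleField.gammaMetric_symm _ _
  metric_nondegenerate x v h := by
    have hφ := DoubleField.chart_mem_doubleAtlas (m := m) x
    have hx := mem_chart_source (DoubleField.DModel m) x
    refine DoubleField.tangent_ext hφ hx fun k => ?_
    rw [map_zero]
    rcases k with i | i
    · rw [← DoubleField.gammaMetric_coordVF_inr hφ hx, h]
    · rw [← DoubleField.gammaMetric_coordVF_inl hφ hx, h]
  metric_foliated _ hU _ _ hs ht := DoubleField.isFoliatedFun_gammaMetric hs ht hU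
  anchor_foliated U hU s hs x hx := ⟨U, subset_rfl, hU, hx, s, hs.isFoliatedVF hU,
    fun _ _ => DoubleField.anchorL_apply _⟩
  partial_foliated _ hU _ hf := DoubleField.isStrFoliated_transPartial hf hU
  bracket_local _ _ _ _ _ hs ht := DoubleField.bracket0_congr hs ht
  bracket_foliated _ hU _ _ hs ht := DoubleField.isStrFoliated_bracket0 hs ht hU
  bracket_add _ hU _ _ _ hs hs' ht _ hx := DoubleField.bracket0_add hs hs' ht hU hx
  bracket_smul U hU c s t hs ht x hx := by
    -- Homogeneity is the Leibniz rule for a constant function, for which dc = 0 and ∂c = 0; skew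
    -- symmetry moves the factor to the first argument.
    have hc := DoubleField.isFoliatedFun_const (m := m) (M := M) (U := U) c
    have hcs : DoubleField.IsStrFoliated U (c • s) := DoubleField.IsFoliatedSec.fun_smul hc hs hU
    have h := DoubleField.bracket0_fun_smul ht hs hc hU hx
    have h0 : DoubleField.transPartial (DoubleField.foliationLt m M) (DoubleField.gammaMetric m M)
        (DoubleField.anchorL m M) (fun _ => c) x = 0 := by
      have hφ := DoubleField.chart_mem_doubleAtlas (m := m) x
      have hxφ := mem_chart_source (DoubleField.DModel m) x
      refine DoubleField.tangent_ext hφ hxφ fun k => ?_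
      rw [map_zero]
      rcases k with i | i
      · rw [DoubleField.dcoord_inl_transPartial hc hx hφ hxφ]
      · rw [DoubleField.dcoord_inr_transPartial hc hx hφ hxφ, DoubleField.pd,
          DoubleField.dfun_const]
        simp
    rw [DoubleField.bracket0_skew hcs ht hU hx, DoubleField.bracket0_skew hs ht hU hx]
    refine (congrArg Neg.neg h).trans ?_
    rw [h0, DoubleField.transDiff_anchorL hc hx, DoubleField.dfun_const]
    simp
  bracket_skew _ hU _ _ hs ht _ hx := DoubleField.bracket0_skew hs ht hU hx
  jacobi _ hU _ _ _ h₁ h₂ h₃ _ hx := DoubleField.bracket0_jacobi h₁ h₂ h₃ hU hx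
  anchor_bracket _ hU _ _ h₁ h₂ _ _ hX₁ hX₂ h h' _ hx :=
    DoubleField.anchorL_bracket0 h₁ h₂ hU hX₁.1 hX₂.1 h h' hx
  leibniz _ hU _ _ _ h₁ h₂ hf _ hx := DoubleField.bracket0_fun_smul h₁ h₂ hf hU hx
  anchor_partial _ _ _ hf _ hx := DoubleField.anchorL_transPartial hf hx
  compatible _ hU _ _ _ h h₁ h₂ _ hx := DoubleField.bracket0_compatible h h₁ h₂ hU hx
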